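/- Let $K(x,y)=\dfrac{\sin\pi(x-y)}{\pi(x-y)}$ (with $K(x,x)=1$) be the sine kernel. For $s\ge 0$ and $\lambda\in\mathbb R$ let $D(s;\lambda)=\det(1-\lambda K)$ be the Fredholm determinant of $K$ on $L^2(-s/2,s/2)$, and let $D_\pm(s;\lambda)=\det(1-\lambda K_\pm)$, where $K_\pm$ is the operator on $L^2(0,s/2)$ with kernel $K(x,y)\pm K(-x,y)$ (equivalently, the restriction of $K$ to the even, respectively odd, functions on $(-s/2,s/2)$). Here the Fredholm determinant of a kernel $k$ on $(a,b)$ is $\sum_{n\ge0}\frac{(-\lambda)^n}{n!}\int_{(a,b)^n}\det\big(k(x_i,x_j)\big)_{i,j=1}^n\,dx_1\cdots dx_n$. Let $\lambda\in\mathbb R$ and $s>0$, and assume that $\lambda\le 1$ or that $D(x;\lambda)\ne0$ for all $0<x\le s$. Then $D(x;\lambda)$, $D_+(x;\lambda)$ and $D_-(x;\lambda)$ are positive for $0\le x\le s$, the function $x\mapsto\log D(x;\lambda)$ is real-analytic on a neighbourhood of $(0,s]$, and $$\log D_\pm(s;\lambda)=\tfrac12\log D(s;\lambda)\mp\tfrac12\int_0^s\sqrt{-\frac{d^2}{dx^2}\log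 D(x;\lambda)}\;dx ,$$ where the square root is the real-analytic branch with value $\lambda$ at $x=0$: there is a function $w$, real-analytic on a neighbourhood of $[0,s]$, with $w(0)=\lambda$ and $w(x)^2=-\frac{d^2}{dx^2}\log D(x;\lambda)$ for $0<x<s$, and the formula holds with $w$ for the square root, for every such $w$. If $\lambda\ge1$, or if $\lambda>0$ and $\frac{d^2}{dx^2}\log D(x;\lambda)\neq0$ for all $0<x<s$, then $-\frac{d^2}{dx^2}\log D(x;\lambda)>0$ for all $0<x<s$ and the formula holds with the usual nonnegative square root. -/

import Mathlib

open MeasureTheory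

namespace GapProb

/-- The Fredholm determinant `det (1 - lam * k)` of the integral operator with kernel `k`
on `L²(a, b)`, given by the Fredholm expansion
`∑ₙ (-lam)ⁿ / n! ∫_{(a,b)ⁿ} det (k (xᵢ, xⱼ)) dx₁ … dxₙ`. -/
noncomputable def fredholmDet (k : ℝ → ℝ → ℝ) (a b lam : ℝ) : ℝ :=
  ∑' n : ℕ, (-lam) ^ n / (n.factorial : ℝ) *
    ∫ x in Set.univ.pi (fun _ : Fin n => Set.Ioo a b),
      (Matrix.of (fun i j : Fin n => k (x i) (x j))).det

/-- The sine kernel `K(x, y) = sin (π (x - y)) / (π (x - y))`, with `K(x, x) = 1`. -/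
noncomputable def sineKernel (x y : ℝ) : ℝ := Real.sinc (Real.pi * (x - y))

/-- `D(s; lam) = det (1 - lam K)`, with `K` acting on the interval `(-s/2, s/2)` of length `s`. -/
noncomputable def D (s lam : ℝ) : ℝ := fredholmDet sineKernel (-(s / 2)) (s / 2) lam

/-- `D₊(s; lam) = det (1 - lam K₊)`: the operator `K₊` is the restriction of `K` to the even
functions on `(-s/2, s/2)`; in terms of their values on the half interval `(0, s/2)` it has the
kernel `K(x, y) + K(-x, y)`. -/
noncomputable def Dplus (s lam : ℝ) : ℝ :=
  fredholmDet (fun x y => sineKernel x y + sineKernel (-x) y) 0 (s / 2) lam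

/-- `D₋(s; lam) = det (1 - lam K₋)`: the operator `K₋` is the restriction of `K` to the odd
functions on `(-s/2, s/2)`; in terms of their values on the half interval `(0, s/2)` it has the
kernel `K(x, y) - K(-x, y)`. -/
noncomputable def Dminus (s lam : ℝ) : ℝ :=
  fredholmDet (fun x y => sineKernel x y - sineKernel (-x) y) 0 (s / 2) lam

/-- The function `x ↦ -(d²/dx²) log D(x; lam)` under the square root. -/
noncomputable def negLogDeriv2 (lam x : ℝ) : ℝ :=
  -iteratedDeriv 2 (fun y => Real.log (D y lam)) x

/-- `w` is the real-analytic branch on `[0, s]` of the square root of `f` with initial value `c`: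
it is analytic on a neighbourhood of `[0, s]`, its square is `f` on `(0, s)`, and `w 0 = c`. For
`c ≠ 0` there is at most one such branch on `[0, s]`. -/
def IsAnalyticSqrt (f : ℝ → ℝ) (c s : ℝ) (w : ℝ → ℝ) : Prop :=
  AnalyticOnNhd ℝ w (Set.Icc 0 s) ∧ w 0 = c ∧ ∀ x ∈ Set.Ioo 0 s, w x ^ 2 = f x

end GapProb

/-! Let `R` be the kernel of `lam K (1 - lam K)⁻¹` on `(0, s)`, and put `a(s) = R(0, 0) = R(s, s)`
(`edgeDiag`) and `c(s) = R(0, s)` (`edgeCross`). Moving the right endpoint gives `(log D)' = -a`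
(`hasDerivAt_log_D`) and `∂R(x, y)/∂s = R(x, s) R(s, y)` (`hasDerivAt_resolvent`). By symmetry of
`R`, `a' = c²`, so `-(log D)'' = c²` (`negLogDeriv2_eq`). The even and odd resolvents are obtained
from `R` by reflection in the midpoint (`resolvent_parityKernel`), whence `(log D_±)' = -(a ± c) /
2`. Subtracting half of `(log D)'` and integrating gives the formula with `c` as the square root,
and `c(0) = lam` (`log_parityDet_eq`).

It remains to control zeros and signs. Hadamard's inequality makes the Fredholm series entire in
`s`. This gives analyticity, extends `D = D₊ D₋` from small `s` to all `s ≥ 0` (`parityDet_mul`),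
and continues `c = (log D₋ - log D₊)'` analytically through `0`, where the value `lam` selects the
sign (`IsAnalyticSqrt.eq_edgeCross`).

The rest uses that `K` is the projection onto band-limited functions. For `lam < 1`, Plancherel
bounds `a` above, so `D` cannot reach zero; `lam = 1` follows by a limit and the identity theorem.
For `lam ≥ 1`, `c(s) = 0` would make `R(x, s) (x - s) / x` band-limited, and pairing it with `R(x,
s)` would force `a(s) = R(s, s) = 0`, against `a ≥ lam` (`apply_eq_zero_of_apply_zero`,
`edgeCross_ne_zero`). Hence `c` keeps the sign of `lam` there. -/

namespace GapProb

/-! ### Hadamard's inequality and a summable majorant for Fredholm series. -/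

open scoped ComplexOrder in
/-- **Hadamard's inequality** for a matrix with entries bounded by `M`. -/
theorem norm_det_sq_le {n : ℕ} (A : Matrix (Fin n) (Fin n) ℂ) {M : ℝ} (hA : ∀ i j, ‖A i j‖ ≤ M) :
    ‖A.det‖ ^ 2 ≤ (n * M ^ 2) ^ n := by
  rcases Nat.eq_zero_or_pos n with rfl | hn
  · simp
  -- The eigenvalues of `Aᴴ A` have product `‖det A‖²` and sum `∑ ‖A i j‖²`; the inequality is AM-GM
  -- for them.
  have hps : (A.conjTranspose * A).PosSemidef := Matrix.posSemidef_conjTranspose_mul_self A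
  set ev := hps.isHermitian.eigenvalues with hev
  have h0 : ∀ i, 0 ≤ ev i := fun i => hps.eigenvalues_nonneg i
  have hdet : ‖A.det‖ ^ 2 = ∏ i, ev i := by
    have h1 := hps.isHermitian.det_eq_prod_eigenvalues
    rw [Matrix.det_mul, Matrix.det_conjTranspose] at h1
    have h2 : star A.det * A.det = ((‖A.det‖ ^ 2 : ℝ) : ℂ) := by
      simpa using Complex.conj_mul' A.det
    rw [h2] at h1
    have h3 : ((‖A.det‖ ^ 2 : ℝ) : ℂ) = ((∏ i, ev i : ℝ) : ℂ) := by
      rw [h1]; push_cast; rfl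
    exact_mod_cast h3
  have htr : ∑ i, ev i = ∑ j, ∑ i, ‖A i j‖ ^ 2 := by
    have h1 := hps.isHermitian.trace_eq_sum_eigenvalues
    have h2 : (A.conjTranspose * A).trace = ((∑ j, ∑ i, ‖A i j‖ ^ 2 : ℝ) : ℂ) := by
      simp only [Matrix.trace, Matrix.diag_apply, Matrix.mul_apply, Matrix.conjTranspose_apply]
      push_cast
      refine Finset.sum_congr rfl fun j _ => Finset.sum_congr rfl fun i _ => ?_
      simpa using Complex.conj_mul' (A i j)
    rw [h2] at h1
    have h3 : ((∑ j, ∑ i, ‖A i j‖ ^ 2 : ℝ) : ℂ) = ((∑ i, ev i : ℝ) : ℂ) := by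
      rw [h1]; push_cast; rfl
    exact_mod_cast h3.symm
  have hsum : ∑ i, ev i ≤ n * (n * M ^ 2) := by
    rw [htr]
    calc ∑ j, ∑ i, ‖A i j‖ ^ 2 ≤ ∑ _j : Fin n, ∑ _i : Fin n, M ^ 2 :=
          Finset.sum_le_sum fun j _ => Finset.sum_le_sum fun i _ =>
            pow_le_pow_left₀ (norm_nonneg _) (hA i j) 2
      _ = n * (n * M ^ 2) := by simp
  have hn' : (0 : ℝ) < n := by exact_mod_cast hn
  have hamgm := Real.geom_mean_le_arith_mean Finset.univ (fun _ : Fin n => (1 : ℝ)) ev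
    (fun _ _ => zero_le_one) (by simp [hn]) (fun i _ => h0 i)
  simp only [Real.rpow_one, Finset.sum_const, Finset.card_univ, Fintype.card_fin, nsmul_eq_mul,
    mul_one, one_mul] at hamgm
  have hP : 0 ≤ ∏ i, ev i := Finset.prod_nonneg fun i _ => h0 i
  have h5 : (∏ i, ev i) ^ ((n : ℝ)⁻¹) ≤ n * M ^ 2 :=
    hamgm.trans (by rw [div_le_iff₀ hn']; linarith)
  rw [hdet]
  calc ∏ i, ev i = ((∏ i, ev i) ^ ((n : ℝ)⁻¹)) ^ n := (Real.rpow_inv_natCast_pow hP hn.ne').symm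
    _ ≤ _ := pow_le_pow_left₀ (Real.rpow_nonneg hP _) h5 n

/-- A bound for determinants of size `n` and `n + 1` with entries bounded by `M`. -/
noncomputable def hadamardBound (M : ℝ) (n : ℕ) : ℝ := √(((n + 1 : ℕ) * M ^ 2) ^ (n + 1))

theorem hadamardBound_nonneg (M : ℝ) (n : ℕ) : 0 ≤ hadamardBound M n := Real.sqrt_nonneg _

theorem norm_det_succ_le {n : ℕ} (A : Matrix (Fin (n + 1)) (Fin (n + 1)) ℂ) {M : ℝ}
    (hA : ∀ i j, ‖A i j‖ ≤ M) : ‖A.det‖ ≤ hadamardBound M n :=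
  Real.le_sqrt_of_sq_le (norm_det_sq_le A hA)

/-- For `M ≥ 1` the base `(n + 1) M²` is at least `1`, so the larger exponent is harmless. One
majorant thus serves both the `n`-point determinants and the bordered ones of size `n + 1`. -/
theorem norm_det_le {n : ℕ} (A : Matrix (Fin n) (Fin n) ℂ) {M : ℝ} (hM : 1 ≤ M)
    (hA : ∀ i j, ‖A i j‖ ≤ M) : ‖A.det‖ ≤ hadamardBound M n := by
  refine Real.le_sqrt_of_sq_le ((norm_det_sq_le A hA).trans ?_)
  have h1 : (1 : ℝ) ≤ (n + 1 : ℕ) * M ^ 2 := by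
    have : (1 : ℝ) ≤ (n + 1 : ℕ) := by exact_mod_cast Nat.succ_pos n
    nlinarith [one_le_pow₀ hM (n := 2)]
  calc ((n : ℝ) * M ^ 2) ^ n ≤ (((n + 1 : ℕ) : ℝ) * M ^ 2) ^ n := by
        gcongr; simp
    _ ≤ _ := pow_le_pow_right₀ h1 (Nat.le_succ n)

theorem abs_det_succ_le {n : ℕ} (A : Matrix (Fin (n + 1)) (Fin (n + 1)) ℝ) {M : ℝ}
    (hA : ∀ i j, |A i j| ≤ M) : |A.det| ≤ hadamardBound M n := by
  have h := norm_det_succ_le (A.map Complex.ofRealHom) (M := M) (by simpa using hA)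
  rwa [← RingHom.mapMatrix_apply, ← RingHom.map_det, Complex.ofRealHom_eq_coe,
    Complex.norm_real] at h

theorem abs_det_le {n : ℕ} (A : Matrix (Fin n) (Fin n) ℝ) {M : ℝ} (hM : 1 ≤ M)
    (hA : ∀ i j, |A i j| ≤ M) : |A.det| ≤ hadamardBound M n := by
  have h := norm_det_le (A.map Complex.ofRealHom) hM (by simpa using hA)
  rwa [← RingHom.mapMatrix_apply, ← RingHom.map_det, Complex.ofRealHom_eq_coe,
    Complex.norm_real] at h

/-- From `m ^ m ≤ e ^ m m!` with `m = n + 1`, the square of the term `t` is at most a constant times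
`(2Q) ^ n / n!`. Completing a square, `2t ≤ 4 ^ n t² + 4 ^ (-n)`, and both summands on the right are
summable. -/
theorem summable_hadamardBound (C M : ℝ) (hC : 0 ≤ C) :
    Summable fun n : ℕ => C ^ n / n.factorial * hadamardBound M n := by
  set Q : ℝ := C ^ 2 * (M ^ 2 * Real.exp 1) with hQ
  have hs : Summable fun n : ℕ =>
      (M ^ 2 * Real.exp 1) * ((8 * Q) ^ n / n.factorial) + (1 / 4 : ℝ) ^ n :=
    ((Real.summable_pow_div_factorial _).mul_left _).add
      (summable_geometric_of_lt_one (by norm_num) (by norm_num))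
  refine Summable.of_nonneg_of_le
    (fun n => mul_nonneg (by positivity) (hadamardBound_nonneg _ _)) (fun n => ?_) hs
  set t : ℝ := C ^ n / n.factorial * hadamardBound M n with ht
  have hf : (0 : ℝ) < n.factorial := by exact_mod_cast n.factorial_pos
  have h1 : t ^ 2 ≤ (M ^ 2 * Real.exp 1) * ((2 * Q) ^ n / n.factorial) := by
    have hb : hadamardBound M n ^ 2 ≤ (M ^ 2 * Real.exp 1) ^ (n + 1) * ((n + 1) * n.factorial) := by
      rw [hadamardBound, Real.sq_sqrt (by positivity), mul_pow, mul_pow]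
      have := Real.pow_div_factorial_le_exp ((n + 1 : ℕ) : ℝ) (by positivity) (n + 1)
      rw [div_le_iff₀ (by positivity), Nat.factorial_succ, ← mul_one ((n + 1 : ℕ) : ℝ),
        Real.exp_nat_mul] at this
      push_cast at this ⊢
      calc ((n : ℝ) + 1) ^ (n + 1) * (M ^ 2) ^ (n + 1)
          ≤ (Real.exp 1 ^ (n + 1) * ((n + 1) * n.factorial)) * (M ^ 2) ^ (n + 1) := by
            gcongr
            simpa using this
        _ = _ := by ring
    have h2n : ((n : ℝ) + 1) ≤ 2 ^ n := by exact_mod_cast Nat.lt_two_pow_self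
    calc t ^ 2 = (C ^ n / n.factorial) ^ 2 * hadamardBound M n ^ 2 := by rw [ht]; ring
      _ ≤ (C ^ n / n.factorial) ^ 2 *
          ((M ^ 2 * Real.exp 1) ^ (n + 1) * (2 ^ n * n.factorial)) := by
        refine mul_le_mul_of_nonneg_left (hb.trans ?_) (by positivity)
        gcongr
      _ = (M ^ 2 * Real.exp 1) * ((2 * Q) ^ n / n.factorial) := by
        rw [hQ]; field_simp
        ring
  have h4 : (4 : ℝ) ^ n * (1 / 4) ^ n = 1 := by rw [← mul_pow]; norm_num
  have h8 : (4 : ℝ) ^ n * (2 * Q) ^ n = (8 * Q) ^ n := by rw [← mul_pow]; congr 1; ring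
  have h9 : (4 : ℝ) ^ n * t ^ 2 ≤ (M ^ 2 * Real.exp 1) * ((8 * Q) ^ n / n.factorial) := by
    calc (4 : ℝ) ^ n * t ^ 2 ≤ 4 ^ n * ((M ^ 2 * Real.exp 1) * ((2 * Q) ^ n / n.factorial)) := by
          gcongr
      _ = _ := by rw [← h8]; ring
  have hp : (0 : ℝ) < (1 / 4) ^ n := by positivity
  have h10 : 0 ≤ (1 / 4 : ℝ) ^ n * (4 ^ n * t - 1) ^ 2 := by positivity
  have h11 : (1 / 4 : ℝ) ^ n * (4 ^ n * t - 1) ^ 2 = 4 ^ n * t ^ 2 - 2 * t + (1 / 4) ^ n := by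
    linear_combination ((4 : ℝ) ^ n * t ^ 2 - 2 * t) * h4
  have h12 : 0 ≤ t := mul_nonneg (by positivity) (hadamardBound_nonneg _ _)
  linarith

/-! ### Kernel determinants and the recursion for the first minor. -/

/-- A jointly continuous kernel bounded by `M ≥ 1`. -/
structure BddContKernel (k : ℝ → ℝ → ℝ) (M : ℝ) : Prop where
  cont : Continuous fun p : ℝ × ℝ => k p.1 p.2
  one_le : 1 ≤ M
  bdd : ∀ x y, |k x y| ≤ M

/-- The determinant of the matrix with entries `k (p i) (q j)`. -/
noncomputable def detKernel (k : ℝ → ℝ → ℝ) {n : ℕ} (p q : Fin n → ℝ) : ℝ :=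
  (Matrix.of fun i j => k (p i) (q j)).det

section detKernel

variable {k : ℝ → ℝ → ℝ} {M : ℝ} {n : ℕ}

theorem detKernel_comm (hsym : ∀ x y, k x y = k y x) (p q : Fin n → ℝ) :
    detKernel k p q = detKernel k q p := by
  rw [detKernel, ← Matrix.det_transpose, detKernel]
  congr 1
  ext i j
  simp [hsym (p j) (q i)]

theorem BddContKernel.abs_detKernel_le (hk : BddContKernel k M) (p q : Fin n → ℝ) :
    |detKernel k p q| ≤ hadamardBound M n :=
  abs_det_le _ hk.one_le fun _ _ => hk.bdd _ _

theorem BddContKernel.abs_detKernel_cons_le (hk : BddContKernel k M) (p q : Fin (n + 1) → ℝ) :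
    |detKernel k p q| ≤ hadamardBound M n :=
  abs_det_succ_le _ fun _ _ => hk.bdd _ _

theorem BddContKernel.continuous_detKernel (hk : BddContKernel k M) {X : Type*}
    [TopologicalSpace X] {f g : X → Fin n → ℝ} (hf : Continuous f) (hg : Continuous g) :
    Continuous fun x => detKernel k (f x) (g x) := by
  refine Continuous.matrix_det (continuous_matrix fun i j => ?_)
  exact hk.cont.comp (((continuous_apply i).comp hf).prodMk ((continuous_apply j).comp hg))

/-- The Laplace expansions along row `m` and along row `0` have the same minors and differ only in
sign. -/
theorem detKernel_insertNth_left (m : Fin (n + 1)) (z : ℝ) (p : Fin n → ℝ) (c : Fin (n + 1) → ℝ) :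
    detKernel k (m.insertNth z p : Fin (n + 1) → ℝ) c =
      (-1) ^ (m : ℕ) * detKernel k (Matrix.vecCons z p) c := by
  rw [detKernel, detKernel, Matrix.det_succ_row _ m, Matrix.det_succ_row_zero, Finset.mul_sum]
  refine Finset.sum_congr rfl fun l _ => ?_
  have : (Matrix.of fun i j => k ((m.insertNth z p : Fin (n + 1) → ℝ) i) (c j)).submatrix
      m.succAbove l.succAbove =
      (Matrix.of fun i j => k (Matrix.vecCons z p i) (c j)).submatrix Fin.succ l.succAbove := by
    ext i j
    simp
  rw [this]
  simp only [Matrix.of_apply, Fin.insertNth_apply_same, Matrix.cons_val_zero, pow_add]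
  ring

theorem detKernel_insertNth_right (m : Fin (n + 1)) (z : ℝ) (p : Fin n → ℝ)
    (c : Fin (n + 1) → ℝ) :
    detKernel k c (m.insertNth z p : Fin (n + 1) → ℝ) =
      (-1) ^ (m : ℕ) * detKernel k c (Matrix.vecCons z p) := by
  have h := detKernel_insertNth_left (k := fun x y => k y x) m z p c
  have e : ∀ a b : Fin (n + 1) → ℝ, detKernel (fun x y => k y x) a b = detKernel k b a := by
    intro a b
    rw [detKernel, ← Matrix.det_transpose, detKernel]
    rfl
  rwa [e, e] at h

theorem detKernel_insertNth (m : Fin (n + 1)) (z : ℝ) (p : Fin n → ℝ) :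
    detKernel k (m.insertNth z p : Fin (n + 1) → ℝ) (m.insertNth z p : Fin (n + 1) → ℝ) =
      detKernel k (Matrix.vecCons z p) (Matrix.vecCons z p) := by
  rw [detKernel_insertNth_left, detKernel_insertNth_right, ← mul_assoc, ← pow_add, ← two_mul,
    pow_mul]
  simp

/-- Expansion of a bordered determinant along its first row. -/
theorem detKernel_cons_eq (x y : ℝ) (p : Fin (n + 1) → ℝ) :
    detKernel k (Matrix.vecCons x p) (Matrix.vecCons y p) =
      k x y * detKernel k p p - ∑ m, k x (p m) *
        detKernel k (Matrix.vecCons (p m) (m.removeNth p)) (Matrix.vecCons y (m.removeNth p)) := by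
  rw [detKernel, Matrix.det_succ_row_zero, Fin.sum_univ_succ, sub_eq_add_neg,
    ← Finset.sum_neg_distrib]
  congr 1
  · simp [detKernel]
    left
    rfl
  · refine Finset.sum_congr rfl fun m _ => ?_
    -- This minor has rows `p` and columns `y` followed by `p` without `p m`. Bringing row `p m` to
    -- the top costs `(-1) ^ m`, which turns the Laplace sign `(-1) ^ (m + 1)` into `-1`.
    have h : ((Matrix.of fun i j => k (Matrix.vecCons x p i) (Matrix.vecCons y p j)).submatrix
        Fin.succ m.succ.succAbove).det =
        (-1) ^ (m : ℕ) * detKernel k (Matrix.vecCons (p m) (m.removeNth p))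
          (Matrix.vecCons y (m.removeNth p)) := by
      rw [← detKernel_insertNth_left, Fin.insertNth_self_removeNth, detKernel]
      congr 1
      ext i j
      refine Fin.cases ?_ (fun j => ?_) j
      · simp
      · simp [Fin.removeNth]
    rw [h]
    simp only [Matrix.of_apply, Matrix.cons_val_zero, Matrix.cons_val_succ, Fin.val_succ, pow_succ]
    have : ((-1 : ℝ) ^ (m : ℕ)) * (-1) ^ (m : ℕ) = 1 := by
      rw [← pow_add, ← two_mul, pow_mul]; simp
    linear_combination (-k x (p m) * detKernel k (Matrix.vecCons (p m) (m.removeNth p))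
          (Matrix.vecCons y (m.removeNth p))) * this

end detKernel

/-- The integral of `det (k (p i) (p j))` with respect to the power of a measure. -/
noncomputable def detCoeff (k : ℝ → ℝ → ℝ) (μ : Measure ℝ) (n : ℕ) : ℝ :=
  ∫ p, detKernel k p p ∂Measure.pi fun _ : Fin n => μ

/-- The coefficients of the first Fredholm minor. -/
noncomputable def minorCoeff (k : ℝ → ℝ → ℝ) (μ : Measure ℝ) (n : ℕ) (x y : ℝ) : ℝ :=
  ∫ p, detKernel k (Matrix.vecCons x p) (Matrix.vecCons y p) ∂Measure.pi fun _ : Fin n => μ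

theorem detCoeff_zero {k : ℝ → ℝ → ℝ} {μ : Measure ℝ} : detCoeff k μ 0 = 1 := by
  simp [detCoeff, detKernel, Measure.real, Measure.pi_empty_univ]

theorem minorCoeff_zero {k : ℝ → ℝ → ℝ} {μ : Measure ℝ} (x y : ℝ) : minorCoeff k μ 0 x y = k x y := by
  simp [minorCoeff, detKernel, Measure.real, Measure.pi_empty_univ]

section coefficients

variable {k : ℝ → ℝ → ℝ} {M : ℝ} {μ : Measure ℝ} [IsFiniteMeasure μ]

theorem continuous_vecCons {n : ℕ} :
    Continuous fun a : ℝ × (Fin n → ℝ) => (Matrix.vecCons a.1 a.2 : Fin (n + 1) → ℝ) := by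
  fun_prop

theorem BddContKernel.integrable_detKernel {n : ℕ} (hk : BddContKernel k M)
    {X : Type*} [TopologicalSpace X] [MeasurableSpace X] [OpensMeasurableSpace X]
    [SecondCountableTopology X] (ν : Measure X) [IsFiniteMeasure ν]
    {f g : X → Fin n → ℝ} (hf : Continuous f) (hg : Continuous g) :
    Integrable (fun p => detKernel k (f p) (g p)) ν := by
  refine Integrable.of_bound (hk.continuous_detKernel hf hg).aestronglyMeasurable
    (hadamardBound M n) (Filter.Eventually.of_forall fun p => ?_)
  exact hk.abs_detKernel_le _ _

/-- Integration over a power of a measure, with one coordinate split off. -/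
theorem integral_pi_succ {n : ℕ} (m : Fin (n + 1)) (F : (Fin (n + 1) → ℝ) → ℝ) :
    ∫ p, F p ∂(Measure.pi fun _ : Fin (n + 1) => μ) =
      ∫ a : ℝ × (Fin n → ℝ), F (m.insertNth a.1 a.2) ∂(μ.prod (Measure.pi fun _ => μ)) := by
  have h := (measurePreserving_piFinSuccAbove (fun _ : Fin (n + 1) => μ) m).symm
  rw [← h.integral_comp']
  rfl

/-- Fredholm's recursion for the coefficients of the first minor. -/
theorem BddContKernel.minorCoeff_succ (hk : BddContKernel k M) (n : ℕ) (x y : ℝ) :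
    minorCoeff k μ (n + 1) x y = k x y * detCoeff k μ (n + 1) -
      (n + 1) * ∫ z, k x z * minorCoeff k μ n z y ∂μ := by
  have hint : ∀ m : Fin (n + 1), Integrable (fun p : Fin (n + 1) → ℝ => k x (p m) *
      detKernel k (Matrix.vecCons (p m) (m.removeNth p)) (Matrix.vecCons y (m.removeNth p)))
      (Measure.pi fun _ : Fin (n + 1) => μ) := by
    intro m
    have hrem : Continuous fun p : Fin (n + 1) → ℝ => (m.removeNth p : Fin n → ℝ) :=
      continuous_pi fun i => continuous_apply _
    have h1 : Continuous fun p : Fin (n + 1) → ℝ =>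
        (Matrix.vecCons (p m) (m.removeNth p) : Fin (n + 1) → ℝ) :=
      continuous_vecCons.comp ((continuous_apply m).prodMk hrem)
    have h2 : Continuous fun p : Fin (n + 1) → ℝ =>
        (Matrix.vecCons y (m.removeNth p) : Fin (n + 1) → ℝ) :=
      continuous_vecCons.comp (continuous_const.prodMk hrem)
    have h3 : Continuous fun p : Fin (n + 1) → ℝ => k x (p m) :=
      hk.cont.comp (continuous_const.prodMk (continuous_apply m))
    refine (hk.integrable_detKernel _ h1 h2).bdd_mul (c := M) h3.aestronglyMeasurable
      (Filter.Eventually.of_forall fun p => hk.bdd _ _)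
  -- The integral does not depend on `m`, which accounts for the factor `n + 1`.
  have hterm : ∀ m : Fin (n + 1), ∫ p : Fin (n + 1) → ℝ, k x (p m) *
      detKernel k (Matrix.vecCons (p m) (m.removeNth p)) (Matrix.vecCons y (m.removeNth p))
      ∂(Measure.pi fun _ : Fin (n + 1) => μ) = ∫ z, k x z * minorCoeff k μ n z y ∂μ := by
    intro m
    rw [integral_pi_succ m]
    simp only [Fin.insertNth_apply_same, Fin.removeNth_insertNth]
    rw [integral_prod]
    · simp only [minorCoeff, integral_const_mul]
    · have h3 : Continuous fun a : ℝ × (Fin n → ℝ) => k x a.1 :=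
        hk.cont.comp (continuous_const.prodMk continuous_fst)
      refine (hk.integrable_detKernel _ continuous_vecCons
        (continuous_vecCons.comp (continuous_const.prodMk continuous_snd))).bdd_mul (c := M)
        h3.aestronglyMeasurable (Filter.Eventually.of_forall fun p => hk.bdd _ _)
  rw [minorCoeff]
  simp only [detKernel_cons_eq]
  rw [integral_sub, integral_const_mul, integral_finsetSum _ fun m _ => hint m]
  · simp only [hterm, detCoeff]
    simp
  · exact (hk.integrable_detKernel _ continuous_id continuous_id).const_mul _
  · exact integrable_finsetSum _ fun m _ => hint m

end coefficients

/-! ### Endpoint dependence of the coefficients. -/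

/-- Lebesgue measure on `(0, s)`. -/
noncomputable abbrev volIoo (s : ℝ) : Measure ℝ := volume.restrict (Set.Ioo 0 s)

theorem pi_volIoo (s : ℝ) (n : ℕ) : (Measure.pi fun _ : Fin n => volIoo s) =
    volume.restrict (Set.univ.pi fun _ : Fin n => Set.Ioo (0 : ℝ) s) := by
  rw [volume_pi, Measure.restrict_pi_pi]

/-- A proper subspace is null; this discards the points whose largest coordinate is not unique. -/
theorem volume_eq_apply_null {n : ℕ} {i j : Fin n} (hij : i ≠ j) :
    volume {p : Fin n → ℝ | p i = p j} = 0 := by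
  let L : (Fin n → ℝ) →ₗ[ℝ] ℝ := 
    LinearMap.proj (R := ℝ) (φ := fun _ : Fin n => ℝ) i - LinearMap.proj j
  have h : {p : Fin n → ℝ | p i = p j} = (LinearMap.ker L : Set (Fin n → ℝ)) := by
    ext p
    simp [L, sub_eq_zero]
  rw [h]
  refine Measure.addHaar_submodule _ _ fun htop => ?_
  have h1 : (Pi.single i 1 : Fin n → ℝ) ∈ LinearMap.ker L := by rw [htop]; trivial
  simp [L, hij.symm] at h1

/-- Decomposition of an integral over a cube according to the largest coordinate. -/
theorem integral_cube_eq_sum {n : ℕ} (s : ℝ) (F : (Fin (n + 1) → ℝ) → ℝ)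
    (hF : IntegrableOn F (Set.univ.pi fun _ : Fin (n + 1) => Set.Ioo (0 : ℝ) s)) :
    ∫ p in Set.univ.pi (fun _ : Fin (n + 1) => Set.Ioo (0 : ℝ) s), F p =
      ∑ m : Fin (n + 1), ∫ z in Set.Ioo 0 s,
        ∫ q in Set.univ.pi (fun _ : Fin n => Set.Ioo (0 : ℝ) z), F (m.insertNth z q) := by
  set C : Set (Fin (n + 1) → ℝ) := Set.univ.pi fun _ => Set.Ioo (0 : ℝ) s with hC
  let S : Fin (n + 1) → Set (Fin (n + 1) → ℝ) := fun m => C ∩ {p | ∀ j, j ≠ m → p j < p m}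
  have hCm : MeasurableSet C := MeasurableSet.univ_pi fun _ => measurableSet_Ioo
  have hSm : ∀ m, MeasurableSet (S m) := by
    intro m
    refine hCm.inter ?_
    have : {p : Fin (n + 1) → ℝ | ∀ j, j ≠ m → p j < p m} =
        ⋂ j, ⋂ (_ : j ≠ m), {p : Fin (n + 1) → ℝ | p j < p m} := by ext; simp
    rw [this]
    exact MeasurableSet.iInter fun j => MeasurableSet.iInter fun _ =>
      measurableSet_lt (measurable_pi_apply j) (measurable_pi_apply m)
  have hdisj : Pairwise (Function.onFun Disjoint S) := by
    intro m m' hmm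
    refine Set.disjoint_left.2 fun p hp hp' => ?_
    exact lt_asymm (hp.2 m' hmm.symm) (hp'.2 m hmm)
  have hae : (⋃ m, S m : Set (Fin (n + 1) → ℝ)) =ᵐ[volume] C := by
    have hne : ∀ᵐ p : Fin (n + 1) → ℝ, ∀ i j, i ≠ j → p i ≠ p j := by
      refine ae_all_iff.2 fun i => ae_all_iff.2 fun j => ?_
      by_cases hij : i = j
      · simp [hij]
      · have := volume_eq_apply_null hij
        filter_upwards [compl_mem_ae_iff.2 this] with p hp _
        exact hp
    filter_upwards [hne] with p hp
    refine propext ⟨fun h => ?_, fun h => ?_⟩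
    · obtain ⟨m, hm⟩ := Set.mem_iUnion.1 h
      exact hm.1
    · obtain ⟨m, hm⟩ := Finite.exists_max p
      exact Set.mem_iUnion.2 ⟨m, h, fun j hj => lt_of_le_of_ne (hm j) (hp j m hj)⟩
  rw [← setIntegral_congr_set hae, integral_iUnion_fintype hSm hdisj]
  · refine Finset.sum_congr rfl fun m _ => ?_
    have hind : IntegrableOn F (S m) := hF.mono_set Set.inter_subset_left
    have hmp := (volume_preserving_piFinSuccAbove (fun _ : Fin (n + 1) => ℝ) m).symm
    have hpre : (MeasurableEquiv.piFinSuccAbove (fun _ : Fin (n + 1) => ℝ) m).symm ⁻¹' S m =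
        {a : ℝ × (Fin n → ℝ) | a.1 ∈ Set.Ioo 0 s ∧
          a.2 ∈ Set.univ.pi fun _ : Fin n => Set.Ioo (0 : ℝ) a.1} := by
      ext ⟨z, q⟩
      have : (MeasurableEquiv.piFinSuccAbove (fun _ : Fin (n + 1) => ℝ) m).symm (z, q) =
        m.insertNth z q := rfl
      simp only [S, hC, Set.mem_preimage, this, Set.mem_inter_iff, Set.mem_univ_pi,
        Set.mem_ofPred_eq]
      constructor
      · rintro ⟨h1, h2⟩
        refine ⟨by simpa using h1 m, fun i => ⟨?_, ?_⟩⟩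
        · simpa using (h1 (m.succAbove i)).1
        · simpa using h2 (m.succAbove i) (Fin.succAbove_ne m i)
      · rintro ⟨h1, h2⟩
        refine ⟨fun i => ?_, fun j hj => ?_⟩
        · refine Fin.succAboveCases m ?_ (fun i => ?_) i
          · simpa using h1
          · simpa using ⟨(h2 i).1, (h2 i).2.trans h1.2⟩
        · obtain ⟨i, rfl⟩ := Fin.exists_succAbove_eq hj
          simpa using (h2 i).2
    set T : Set (ℝ × (Fin n → ℝ)) := {a | a.1 ∈ Set.Ioo 0 s ∧
          a.2 ∈ Set.univ.pi fun _ : Fin n => Set.Ioo (0 : ℝ) a.1} with hT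
    have hTm : MeasurableSet T := by
      rw [← hpre]
      exact (MeasurableEquiv.measurable _) (hSm m)
    rw [← hmp.setIntegral_preimage_emb (MeasurableEquiv.measurableEmbedding _), hpre]
    have hintT : IntegrableOn (fun a : ℝ × (Fin n → ℝ) => F (m.insertNth a.1 a.2)) T := by
      have := (hmp.integrableOn_comp_preimage (MeasurableEquiv.measurableEmbedding _)).2 hind
      rw [hpre] at this
      exact this
    change ∫ a in T, F (m.insertNth a.1 a.2) = _
    rw [← integral_indicator hTm, Measure.volume_eq_prod, integral_prod,
      ← integral_indicator measurableSet_Ioo]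
    · refine integral_congr_ae (Filter.Eventually.of_forall fun z => ?_)
      by_cases hz : z ∈ Set.Ioo 0 s
      · simp only [Set.indicator_of_mem hz]
        rw [← integral_indicator (MeasurableSet.univ_pi fun _ => measurableSet_Ioo)]
        refine integral_congr_ae (Filter.Eventually.of_forall fun q => ?_)
        by_cases hq : q ∈ Set.univ.pi fun _ : Fin n => Set.Ioo (0 : ℝ) z
        · have : (z, q) ∈ T := ⟨hz, hq⟩
          simp only [Set.indicator_of_mem hq, Set.indicator_of_mem this]
        · have : (z, q) ∉ T := fun h => hq h.2
          simp only [Set.indicator_of_notMem hq, Set.indicator_of_notMem this]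
      · simp only [Set.indicator_of_notMem hz]
        have : ∀ q : Fin n → ℝ, (z, q) ∉ T := fun q h => hz h.1
        simp [Set.indicator_of_notMem (this _)]
    · rw [← Measure.volume_eq_prod]
      exact (integrable_indicator_iff hTm).2 hintT
  · exact fun m => hF.mono_set Set.inter_subset_left

/-- Any of the `n + 1` points may be the largest, with equal contributions, and the others then fill
`(0, z)ⁿ`. The coefficient is therefore a primitive in `s`, which is why the endpoint derivative of
the determinant is a first minor. -/
theorem BddContKernel.detCoeff_succ {k : ℝ → ℝ → ℝ} {M : ℝ} (hk : BddContKernel k M) (n : ℕ)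
    (s : ℝ) : detCoeff k (volIoo s) (n + 1) =
      (n + 1) * ∫ z in Set.Ioo 0 s, minorCoeff k (volIoo z) n z z := by
  have hF : IntegrableOn (fun p : Fin (n + 1) → ℝ => detKernel k p p)
      (Set.univ.pi fun _ : Fin (n + 1) => Set.Ioo (0 : ℝ) s) := by
    rw [IntegrableOn, ← pi_volIoo]
    exact hk.integrable_detKernel _ continuous_id continuous_id
  rw [detCoeff, pi_volIoo, integral_cube_eq_sum s _ hF]
  simp only [detKernel_insertNth, minorCoeff, pi_volIoo]
  simp

/-! ### The first Fredholm minor and Fredholm's identities. -/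

/-- The coefficients of the first Fredholm minor on `(0, s)`, with the domain of integration
rescaled to the unit cube. -/
noncomputable def scaledMinorCoeff (k : ℝ → ℝ → ℝ) (n : ℕ) (s x y : ℝ) : ℝ :=
  s ^ n * ∫ p, detKernel k (Matrix.vecCons x (s • p)) (Matrix.vecCons y (s • p))
    ∂Measure.pi fun _ : Fin n => volIoo 1

/-- The first Fredholm minor of the kernel `k` on `(0, s)`. -/
noncomputable def fredholmMinor (k : ℝ → ℝ → ℝ) (lam s x y : ℝ) : ℝ :=
  ∑' n : ℕ, (-lam) ^ n / (n.factorial : ℝ) * scaledMinorCoeff k n s x y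

instance isProbabilityMeasure_volIoo_one : IsProbabilityMeasure (volIoo 1) :=
  ⟨by simp⟩

open scoped Pointwise in
theorem smul_unit_cube {s : ℝ} (hs : 0 < s) (n : ℕ) :
    s • (Set.univ.pi fun _ : Fin n => Set.Ioo (0 : ℝ) 1) =
      Set.univ.pi fun _ : Fin n => Set.Ioo (0 : ℝ) s := by
  ext p
  rw [Set.mem_smul_set_iff_inv_smul_mem₀ hs.ne']
  simp only [Set.mem_univ_pi, Pi.smul_apply, smul_eq_mul, Set.mem_Ioo]
  refine forall_congr' fun i => ?_
  rw [inv_mul_eq_div, lt_div_iff₀ hs, div_lt_iff₀ hs, zero_mul, one_mul]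

theorem integral_pi_volIoo {E : Type*} [NormedAddCommGroup E] [NormedSpace ℝ E] {s : ℝ}
    (hs : 0 < s) (n : ℕ) (F : (Fin n → ℝ) → E) :
    ∫ p, F p ∂(Measure.pi fun _ : Fin n => volIoo s) =
      s ^ n • ∫ p, F (s • p) ∂(Measure.pi fun _ : Fin n => volIoo 1) := by
  rw [pi_volIoo, pi_volIoo, Measure.setIntegral_comp_smul_of_pos _ _ _ hs, smul_unit_cube hs,
    Module.finrank_fin_fun, smul_smul, mul_inv_cancel₀ (pow_ne_zero _ hs.ne'), one_smul]

theorem minorCoeff_volIoo (k : ℝ → ℝ → ℝ) {s : ℝ} (hs : 0 < s) (n : ℕ) (x y : ℝ) :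
    minorCoeff k (volIoo s) n x y = scaledMinorCoeff k n s x y := by
  rw [minorCoeff, integral_pi_volIoo hs, scaledMinorCoeff, smul_eq_mul]

theorem hasSum_integral_of_bound {α : Type*} [MeasurableSpace α] {μ : Measure α}
    [IsFiniteMeasure μ] {F : ℕ → α → ℝ} {u : ℕ → ℝ}
    (hF : ∀ n, AEStronglyMeasurable (F n) μ) (hu : Summable u)
    (hb : ∀ n, ∀ᵐ a ∂μ, |F n a| ≤ u n) :
    HasSum (fun n => ∫ a, F n a ∂μ) (∫ a, ∑' n, F n a ∂μ) := by
  have hint : ∀ n, Integrable (F n) μ := fun n => Integrable.of_bound (hF n) (u n) (hb n)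
  refine hasSum_integral_of_summable_integral_norm hint ?_
  refine Summable.of_nonneg_of_le (fun n => integral_nonneg fun a => norm_nonneg _) (fun n => ?_)
    (hu.mul_left (μ.real Set.univ))
  calc ∫ a, ‖F n a‖ ∂μ ≤ ∫ _, u n ∂μ :=
        integral_mono_ae (hint n).norm (integrable_const _) (hb n)
    _ = μ.real Set.univ * u n := by simp

section

variable {k : ℝ → ℝ → ℝ} {M : ℝ}

theorem scaledMinorCoeff_comm (hsym : ∀ x y, k x y = k y x) (n : ℕ) (s x y : ℝ) :
    scaledMinorCoeff k n s x y = scaledMinorCoeff k n s y x := by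
  simp only [scaledMinorCoeff]
  congr 2
  ext p
  exact detKernel_comm hsym _ _

theorem fredholmMinor_comm (hsym : ∀ x y, k x y = k y x) (lam s x y : ℝ) :
    fredholmMinor k lam s x y = fredholmMinor k lam s y x := by
  simp only [fredholmMinor, scaledMinorCoeff_comm hsym _ s x y]

theorem fredholmMinor_zero (lam x y : ℝ) : fredholmMinor k lam 0 x y = k x y := by
  rw [fredholmMinor, tsum_eq_single 0]
  · simp [scaledMinorCoeff, detKernel, Measure.real]
  · intro n hn
    simp [scaledMinorCoeff, hn]

/-- On the fixed unit cube `s` enters only through the integrand and the prefactor, so dominated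
convergence gives joint continuity, also at `s = 0`. -/
theorem BddContKernel.continuous_scaledMinorCoeff (hk : BddContKernel k M) (n : ℕ) :
    Continuous fun a : ℝ × ℝ × ℝ => scaledMinorCoeff k n a.1 a.2.1 a.2.2 := by
  refine (continuous_fst.pow n).mul ?_
  refine continuous_of_dominated (bound := fun _ => hadamardBound M n) ?_ ?_
    (integrable_const _) ?_
  · intro a
    refine (hk.continuous_detKernel ?_ ?_).aestronglyMeasurable
    · exact continuous_vecCons.comp (continuous_const.prodMk (continuous_const_smul _))
    · exact continuous_vecCons.comp (continuous_const.prodMk (continuous_const_smul _))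
  · exact fun a => Filter.Eventually.of_forall fun p => hk.abs_detKernel_cons_le _ _
  · refine Filter.Eventually.of_forall fun p => hk.continuous_detKernel ?_ ?_
    · exact continuous_vecCons.comp (Continuous.prodMk (by fun_prop) (by fun_prop))
    · exact continuous_vecCons.comp (Continuous.prodMk (by fun_prop) (by fun_prop))

theorem BddContKernel.abs_scaledMinorCoeff_le (hk : BddContKernel k M) (n : ℕ) (s x y : ℝ) :
    |scaledMinorCoeff k n s x y| ≤ |s| ^ n * hadamardBound M n := by
  rw [scaledMinorCoeff, abs_mul, abs_pow]
  refine mul_le_mul_of_nonneg_left ?_ (by positivity)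
  have h := norm_integral_le_of_norm_le_const (μ := Measure.pi fun _ : Fin n => volIoo 1)
    (C := hadamardBound M n)
    (f := fun p => detKernel k (Matrix.vecCons x (s • p)) (Matrix.vecCons y (s • p)))
    (Filter.Eventually.of_forall fun p => hk.abs_detKernel_cons_le _ _)
  simpa using h

theorem BddContKernel.abs_minor_term_le (hk : BddContKernel k M) (lam : ℝ) {S : ℝ} (n : ℕ)
    {s : ℝ} (x y : ℝ) (hs : |s| ≤ S) :
    |(-lam) ^ n / (n.factorial : ℝ) * scaledMinorCoeff k n s x y| ≤
      (|lam| * S) ^ n / n.factorial * hadamardBound M n := by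
  rw [abs_mul, abs_div, abs_pow, abs_neg, Nat.abs_cast]
  calc |lam| ^ n / n.factorial * |scaledMinorCoeff k n s x y|
      ≤ |lam| ^ n / n.factorial * (S ^ n * hadamardBound M n) := by
        refine mul_le_mul_of_nonneg_left ((hk.abs_scaledMinorCoeff_le n s x y).trans ?_)
          (by positivity)
        exact mul_le_mul_of_nonneg_right (pow_le_pow_left₀ (abs_nonneg _) hs n)
          (hadamardBound_nonneg _ _)
    _ = _ := by rw [mul_pow]; ring

theorem BddContKernel.continuous_fredholmMinor (hk : BddContKernel k M) (lam : ℝ) :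
    Continuous fun a : ℝ × ℝ × ℝ => fredholmMinor k lam a.1 a.2.1 a.2.2 := by
  rw [continuous_iff_continuousAt]
  intro a
  have hopen : IsOpen {b : ℝ × ℝ × ℝ | |b.1| < |a.1| + 1} :=
    isOpen_lt (continuous_fst.abs) continuous_const
  refine ContinuousOn.continuousAt (s := {b : ℝ × ℝ × ℝ | |b.1| < |a.1| + 1}) ?_
    (hopen.mem_nhds (by simp))
  refine continuousOn_tsum
    (fun n => ((hk.continuous_scaledMinorCoeff n).const_mul _).continuousOn)
    (summable_hadamardBound (|lam| * (|a.1| + 1)) M (by positivity)) fun n b hb => ?_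
  exact hk.abs_minor_term_le lam n _ _ (le_of_lt hb)

theorem fredholmDet_eq_tsum (k : ℝ → ℝ → ℝ) (s lam : ℝ) :
    fredholmDet k 0 s lam =
      ∑' n : ℕ, (-lam) ^ n / (n.factorial : ℝ) * detCoeff k (volIoo s) n := by
  simp only [fredholmDet, detCoeff, pi_volIoo]
  rfl

theorem BddContKernel.summable_det_term (hk : BddContKernel k M) (s lam : ℝ) :
    Summable fun n : ℕ => (-lam) ^ n / (n.factorial : ℝ) * detCoeff k (volIoo s) n := by
  refine Summable.of_norm_bounded
    (summable_hadamardBound (|lam| * (volIoo s).real Set.univ) M (by positivity)) fun n => ?_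
  have h := norm_integral_le_of_norm_le_const (μ := Measure.pi fun _ : Fin n => volIoo s)
    (C := hadamardBound M n) (f := fun p => detKernel k p p)
    (Filter.Eventually.of_forall fun p => hk.abs_detKernel_le _ _)
  have h2 : (Measure.pi fun _ : Fin n => volIoo s).real Set.univ =
      ((volIoo s).real Set.univ) ^ n := by
    simp [Measure.real, Measure.pi_univ]
  rw [h2] at h
  rw [norm_mul, norm_div, norm_pow, norm_neg, Real.norm_natCast, Real.norm_eq_abs]
  calc |lam| ^ n / n.factorial * ‖detCoeff k (volIoo s) n‖
      ≤ |lam| ^ n / n.factorial * (hadamardBound M n * (volIoo s).real Set.univ ^ n) := by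
        exact mul_le_mul_of_nonneg_left h (by positivity)
    _ = _ := by rw [mul_pow]; ring

/-- The derivative of the Fredholm determinant with respect to the endpoint, in integrated
form. -/
theorem BddContKernel.fredholmDet_eq (hk : BddContKernel k M) (lam : ℝ) {s : ℝ} (hs : 0 ≤ s) :
    fredholmDet k 0 s lam = 1 - lam * ∫ z in (0 : ℝ)..s, fredholmMinor k lam z z z := by
  rw [fredholmDet_eq_tsum, (hk.summable_det_term s lam).tsum_eq_zero_add, detCoeff_zero,
    intervalIntegral.integral_of_le hs, integral_Ioc_eq_integral_Ioo]
  have hsum := hasSum_integral_of_bound (μ := volIoo s)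
    (F := fun n z => (-lam) ^ n / (n.factorial : ℝ) * scaledMinorCoeff k n z z z)
    (u := fun n => (|lam| * s) ^ n / n.factorial * hadamardBound M n)
    (fun n => (((hk.continuous_scaledMinorCoeff n).comp
      (continuous_id.prodMk (continuous_id.prodMk continuous_id))).const_mul
      _).aestronglyMeasurable)
    (summable_hadamardBound _ M (by positivity))
    (fun n => by
      filter_upwards [ae_restrict_mem measurableSet_Ioo] with z hz
      exact hk.abs_minor_term_le lam n z z (by rw [abs_of_pos hz.1]; exact hz.2.le))
  have h1 : ∀ n : ℕ, (-lam) ^ (n + 1) / ((n + 1).factorial : ℝ) * detCoeff k (volIoo s) (n + 1) =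
      -lam * ∫ z in Set.Ioo 0 s, (-lam) ^ n / (n.factorial : ℝ) * scaledMinorCoeff k n z z z := by
    intro n
    rw [hk.detCoeff_succ, integral_const_mul, setIntegral_congr_fun measurableSet_Ioo
      (fun z hz => minorCoeff_volIoo k hz.1 n z z), Nat.factorial_succ]
    push_cast
    field_simp
    ring
  simp only [h1]
  rw [(hsum.mul_left (-lam)).tsum_eq]
  simp only [fredholmMinor]
  ring

/-- Fredholm's identity for the first minor. -/
theorem BddContKernel.fredholmMinor_eq (hk : BddContKernel k M) (lam : ℝ) {s : ℝ} (hs : 0 < s)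
    (x y : ℝ) : fredholmMinor k lam s x y = k x y * fredholmDet k 0 s lam +
      lam * ∫ z in (0 : ℝ)..s, k x z * fredholmMinor k lam s z y := by
  rw [intervalIntegral.integral_of_le hs.le, integral_Ioc_eq_integral_Ioo, fredholmDet_eq_tsum,
    (hk.summable_det_term s lam).tsum_eq_zero_add, detCoeff_zero]
  have hkx : Continuous fun z => k x z := hk.cont.comp (continuous_const.prodMk continuous_id)
  have hsum := hasSum_integral_of_bound (μ := volIoo s)
    (F := fun n z => k x z * ((-lam) ^ n / (n.factorial : ℝ) * scaledMinorCoeff k n s z y))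
    (u := fun n => M * ((|lam| * s) ^ n / n.factorial * hadamardBound M n))
    (fun n => (hkx.mul (((hk.continuous_scaledMinorCoeff n).comp
      (continuous_const.prodMk (continuous_id.prodMk continuous_const))).const_mul
      _)).aestronglyMeasurable)
    ((summable_hadamardBound _ M (by positivity)).mul_left M)
    (fun n => Filter.Eventually.of_forall fun z => by
      rw [abs_mul]
      exact mul_le_mul (hk.bdd _ _) (hk.abs_minor_term_le lam n z y (abs_of_pos hs).le)
        (abs_nonneg _) (zero_le_one.trans hk.one_le))
  have hsummable : Summable fun n : ℕ =>
      (-lam) ^ n / (n.factorial : ℝ) * scaledMinorCoeff k n s x y :=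
    Summable.of_norm_bounded (summable_hadamardBound (|lam| * s) M (by positivity)) fun n =>
      hk.abs_minor_term_le lam n x y (abs_of_pos hs).le
  have h1 : ∀ n : ℕ, (-lam) ^ (n + 1) / ((n + 1).factorial : ℝ) * scaledMinorCoeff k (n + 1) s x y =
      k x y * ((-lam) ^ (n + 1) / ((n + 1).factorial : ℝ) * detCoeff k (volIoo s) (n + 1)) +
      lam * ∫ z in Set.Ioo 0 s,
        k x z * ((-lam) ^ n / (n.factorial : ℝ) * scaledMinorCoeff k n s z y) := by
    intro n
    rw [← minorCoeff_volIoo k hs, hk.minorCoeff_succ]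
    have : ∫ z in Set.Ioo 0 s, k x z * ((-lam) ^ n / (n.factorial : ℝ) *
        scaledMinorCoeff k n s z y) = (-lam) ^ n / (n.factorial : ℝ) *
        ∫ z in Set.Ioo 0 s, k x z * minorCoeff k (volIoo s) n z y := by
      rw [← integral_const_mul]
      congr 1
      ext z
      rw [minorCoeff_volIoo k hs]
      ring
    rw [this, Nat.factorial_succ]
    push_cast
    field_simp
    ring
  have hsd := (summable_nat_add_iff 1).2 (hk.summable_det_term s lam)
  conv_lhs => rw [fredholmMinor, hsummable.tsum_eq_zero_add]
  simp only [h1]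
  rw [((hsd.hasSum.mul_left (k x y)).add (hsum.mul_left lam)).tsum_eq]
  have h0 : scaledMinorCoeff k 0 s x y = k x y := by
    rw [← minorCoeff_volIoo k hs, minorCoeff_zero]
  have h2 : ∫ z in Set.Ioo 0 s, k x z * fredholmMinor k lam s z y =
      ∫ z in Set.Ioo 0 s, ∑' n : ℕ,
        k x z * ((-lam) ^ n / (n.factorial : ℝ) * scaledMinorCoeff k n s z y) := by
    simp only [fredholmMinor, tsum_mul_left]
  rw [h2, h0]
  simp
  ring

theorem BddContKernel.hasDerivAt_fredholmDet (hk : BddContKernel k M) (lam : ℝ) {s : ℝ}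
    (hs : 0 < s) : HasDerivAt (fun x => fredholmDet k 0 x lam)
      (-lam * fredholmMinor k lam s s s) s := by
  have hc : Continuous fun z => fredholmMinor k lam z z z :=
    (hk.continuous_fredholmMinor lam).comp
      (continuous_id.prodMk (continuous_id.prodMk continuous_id))
  have h := ((hc.integral_hasStrictDerivAt 0 s).hasDerivAt.const_mul lam).const_sub 1
  rw [neg_mul]
  -- The integrated formula holds for `x ≥ 0` only: for negative `x` the interval is empty and the
  -- determinant is `1`.
  refine h.congr_of_eventuallyEq ?_
  filter_upwards [lt_mem_nhds hs] with x hx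
  exact hk.fredholmDet_eq lam hx.le

theorem BddContKernel.continuousOn_fredholmDet (hk : BddContKernel k M) (lam : ℝ) :
    ContinuousOn (fun x => fredholmDet k 0 x lam) (Set.Ici 0) := by
  have hc : Continuous fun z => fredholmMinor k lam z z z :=
    (hk.continuous_fredholmMinor lam).comp
      (continuous_id.prodMk (continuous_id.prodMk continuous_id))
  refine ContinuousOn.congr (f := fun s => 1 - lam * ∫ z in (0 : ℝ)..s,
    fredholmMinor k lam z z z) ?_ fun s hs => hk.fredholmDet_eq lam hs
  exact (continuous_const.sub (continuous_const.mul
    (intervalIntegral.continuous_primitive (fun a b => hc.intervalIntegrable a b) 0))).continuousOn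

theorem BddContKernel.fredholmDet_zero (hk : BddContKernel k M) (lam : ℝ) :
    fredholmDet k 0 0 lam = 1 := by
  simp [hk.fredholmDet_eq lam le_rfl]

end

/-! ### Entire continuation in the length of the interval. -/

/-- A bounded holomorphic family of functions has a holomorphic integral. -/
theorem differentiable_integral_of_continuous {X : Type*} [TopologicalSpace X]
    [MeasurableSpace X] [OpensMeasurableSpace X] [SecondCountableTopology X] [LocallyCompactSpace X]
    {ν : Measure X} [IsFiniteMeasure ν] {F : X → ℂ → ℂ}
    (hc : Continuous (Function.uncurry F)) (hd : ∀ a, Differentiable ℂ (F a))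
    (hb : ∀ S : ℝ, ∃ C, ∀ᵐ a ∂ν, ∀ z, ‖z‖ ≤ S → ‖F a z‖ ≤ C) :
    Differentiable ℂ fun z => ∫ a, F a z ∂ν := by
  intro z₀
  -- The derivative has to be dominated on the unit ball about `z₀`, and Cauchy's estimate there
  -- uses unit circles; hence the `2`.
  obtain ⟨C, hC⟩ := hb (‖z₀‖ + 2)
  have hcz : ∀ z, Continuous fun a => F a z := fun z =>
    hc.comp (continuous_id.prodMk continuous_const)
  have hm : ∀ z, AEStronglyMeasurable (fun a => F a z) ν := fun z => (hcz z).aestronglyMeasurable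
  have hm' : AEStronglyMeasurable (fun a => deriv (F a) z₀) ν :=
    ((measurable_deriv_with_param hc).comp
      (measurable_id.prodMk measurable_const)).aestronglyMeasurable
  refine (hasDerivAt_integral_of_dominated_loc_of_deriv_le (μ := ν) (F := fun z a => F a z)
    (F' := fun z a => deriv (F a) z) (bound := fun _ => C) (Metric.ball_mem_nhds z₀ one_pos)
    (Filter.Eventually.of_forall hm) ?_ hm' ?_ (integrable_const _) ?_).2.differentiableAt
  · refine Integrable.of_bound (hm z₀) C ?_
    filter_upwards [hC] with a ha using ha z₀ (by linarith)
  · filter_upwards [hC] with a ha z hz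
    have := Complex.norm_deriv_le_of_forall_mem_sphere_norm_le (c := z) (R := 1) (C := C)
      (f := F a) one_pos (hd a).diffContOnCl fun w hw => by
        refine ha w ?_
        have h1 : ‖w - z‖ = 1 := by simpa [dist_eq_norm] using hw
        have h2 : ‖z - z₀‖ < 1 := by simpa [dist_eq_norm] using hz
        calc ‖w‖ = ‖(w - z) + (z - z₀) + z₀‖ := by congr 1; ring
          _ ≤ ‖w - z‖ + ‖z - z₀‖ + ‖z₀‖ := norm_add₃_le
          _ ≤ ‖z₀‖ + 2 := by linarith
    simpa using this
  · exact Filter.Eventually.of_forall fun a z _ => (hd a z).hasDerivAt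

/-- The Fredholm determinant of `k` on `(0, s)` extends to an entire function of `s` if `k`
extends to an entire kernel. -/
theorem BddContKernel.exists_entire_fredholmDet {k : ℝ → ℝ → ℝ} {M : ℝ} (hk : BddContKernel k M)
    {κ : ℂ → ℂ → ℂ} (hκ : Continuous fun p : ℂ × ℂ => κ p.1 p.2)
    (hd : ∀ u v : ℝ, Differentiable ℂ fun z => κ (z * u) (z * v))
    (hκk : ∀ x y : ℝ, κ x y = k x y) (lam : ℝ) :
    ∃ E : ℂ → ℂ, Differentiable ℂ E ∧ ∀ s : ℝ, 0 ≤ s → E s = fredholmDet k 0 s lam := by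
  let A : (n : ℕ) → (Fin n → ℝ) → ℂ → ℂ := fun n p z =>
    (Matrix.of fun i j => κ (z * p i) (z * p j)).det
  have hAc : ∀ n, Continuous (Function.uncurry (A n)) := by
    intro n
    refine Continuous.matrix_det (continuous_matrix fun i j => ?_)
    exact hκ.comp (Continuous.prodMk (by fun_prop) (by fun_prop))
  have hAd : ∀ n p, Differentiable ℂ (A n p) := by
    intro n p
    simp only [A, Matrix.det_apply, Matrix.of_apply]
    exact Differentiable.fun_sum fun σ _ =>
      (Differentiable.fun_finsetProd fun i _ => hd _ _).const_smul _
  have hbd : ∀ S : ℝ, ∃ C : ℝ, 1 ≤ C ∧ ∀ n, ∀ᵐ p ∂(Measure.pi fun _ : Fin n => volIoo 1),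
      ∀ z : ℂ, ‖z‖ ≤ S → ‖A n p z‖ ≤ hadamardBound C n := by
    intro S
    obtain ⟨C, hC⟩ := ((isCompact_closedBall (0 : ℂ) S).prod
      (isCompact_closedBall (0 : ℂ) S)).exists_bound_of_continuousOn hκ.continuousOn
    refine ⟨max C 1, le_max_right _ _, fun n => ?_⟩
    rw [pi_volIoo]
    filter_upwards [ae_restrict_mem (MeasurableSet.univ_pi fun _ => measurableSet_Ioo)]
      with p hp z hz
    refine norm_det_le _ (le_max_right _ _) fun i j => (hC (_, _) ⟨?_, ?_⟩).trans (le_max_left _ _)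
    all_goals
      rw [mem_closedBall_zero_iff, norm_mul, Complex.norm_real]
      refine (mul_le_of_le_one_right (norm_nonneg _) ?_).trans hz
      rw [Real.norm_eq_abs, abs_of_pos (hp _ trivial).1]
      exact (hp _ trivial).2.le
  let T : ℕ → ℂ → ℂ := fun n z => (-lam : ℂ) ^ n / (n.factorial : ℂ) *
    (z ^ n * ∫ p, A n p z ∂(Measure.pi fun _ : Fin n => volIoo 1))
  have hTd : ∀ n, Differentiable ℂ (T n) := by
    intro n
    refine ((differentiable_id.pow n).mul ?_).const_mul _
    refine differentiable_integral_of_continuous (hAc n) (hAd n) fun S => ?_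
    obtain ⟨C, -, hC⟩ := hbd S
    exact ⟨_, hC n⟩
  refine ⟨fun z => ∑' n, T n z, fun z₀ => ?_, fun s hs => ?_⟩
  · obtain ⟨C, hC1, hC⟩ := hbd (‖z₀‖ + 1)
    have hopen : IsOpen (Metric.ball (0 : ℂ) (‖z₀‖ + 1)) := Metric.isOpen_ball
    refine (Complex.differentiableOn_tsum_of_summable_norm
      (summable_hadamardBound (|lam| * (‖z₀‖ + 1)) C (by positivity))
      (fun n => (hTd n).differentiableOn) hopen fun n z hz => ?_).differentiableAt
      (hopen.mem_nhds (by simp))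
    have hz' : ‖z‖ ≤ ‖z₀‖ + 1 := (mem_ball_zero_iff.1 hz).le
    have h := norm_integral_le_of_norm_le_const (μ := Measure.pi fun _ : Fin n => volIoo 1)
      (C := hadamardBound C n) (f := fun p => A n p z) (by
        filter_upwards [hC n] with p hp using hp z hz')
    have h2 : ‖∫ p, A n p z ∂(Measure.pi fun _ : Fin n => volIoo 1)‖ ≤ hadamardBound C n := by
      simpa using h
    simp only [T]
    rw [norm_mul, norm_div, norm_pow, norm_neg, Complex.norm_real, Complex.norm_natCast, norm_mul,
      norm_pow, Real.norm_eq_abs, mul_pow]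
    calc |lam| ^ n / n.factorial * (‖z‖ ^ n * ‖∫ p, A n p z ∂(Measure.pi fun _ => volIoo 1)‖)
        ≤ |lam| ^ n / n.factorial * ((‖z₀‖ + 1) ^ n * hadamardBound C n) := by
          gcongr
      _ = _ := by ring
  · have hA : ∀ n (p : Fin n → ℝ), A n p s = (detKernel k (s • p) (s • p) : ℝ) := by
      intro n p
      simp only [A, detKernel]
      refine Eq.trans ?_ (RingHom.map_det Complex.ofRealHom _).symm
      congr 1
      ext i j
      simp [← hκk]
    rw [fredholmDet_eq_tsum]
    push_cast
    refine tsum_congr fun n => ?_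
    simp only [T, hA]
    rw [integral_complex_ofReal]
    congr 1
    -- The rescaling of the cube needs `s > 0`, so `s = 0` is checked by hand.
    rcases hs.eq_or_lt with rfl | hs
    · rcases Nat.eq_zero_or_pos n with rfl | hn
      · simp [detCoeff, detKernel, Measure.real]
      · have : detCoeff k (volIoo 0) n = 0 := by
          obtain ⟨m, rfl⟩ := Nat.exists_eq_succ_of_ne_zero hn.ne'
          simp [hk.detCoeff_succ]
        simp [this, hn.ne']
    · rw [detCoeff, integral_pi_volIoo hs]
      simp

/-! ### The resolvent and its dependence on the interval. -/

theorem intervalIntegral_swap {E : Type*} [NormedAddCommGroup E] [NormedSpace ℝ E]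
    {f : ℝ → ℝ → E} (hf : Continuous (Function.uncurry f))
    (a b c d : ℝ) : ∫ x in a..b, ∫ y in c..d, f x y = ∫ y in c..d, ∫ x in a..b, f x y := by
  refine intervalIntegral_intervalIntegral_swap ?_
  exact (hf.continuousOn.integrableOn_compact (isCompact_uIcc.prod isCompact_uIcc)).mono_set
    (Set.prod_mono Set.uIoc_subset_uIcc Set.uIoc_subset_uIcc)

/-- The kernel of `lam k (1 - lam k)⁻¹` on `(0, s)`. -/
noncomputable def resolvent (k : ℝ → ℝ → ℝ) (lam s x y : ℝ) : ℝ :=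
  lam * fredholmMinor k lam s x y / fredholmDet k 0 s lam

section

variable {k : ℝ → ℝ → ℝ} {M lam s : ℝ}

theorem resolvent_comm (hsym : ∀ x y, k x y = k y x) (x y : ℝ) :
    resolvent k lam s x y = resolvent k lam s y x := by
  rw [resolvent, fredholmMinor_comm hsym, resolvent]

theorem BddContKernel.continuous_resolvent (hk : BddContKernel k M) (lam s : ℝ) :
    Continuous fun p : ℝ × ℝ => resolvent k lam s p.1 p.2 := by
  refine (continuous_const.mul ?_).div_const _
  exact (hk.continuous_fredholmMinor lam).comp (continuous_const.prodMk continuous_id)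

theorem BddContKernel.resolvent_eq (hk : BddContKernel k M) (hs : 0 < s)
    (hD : fredholmDet k 0 s lam ≠ 0) (x y : ℝ) :
    resolvent k lam s x y =
      lam * k x y + lam * ∫ z in (0 : ℝ)..s, k x z * resolvent k lam s z y := by
  have h : ∫ z in (0 : ℝ)..s, k x z * resolvent k lam s z y =
      lam / fredholmDet k 0 s lam * ∫ z in (0 : ℝ)..s, k x z * fredholmMinor k lam s z y := by
    rw [← intervalIntegral.integral_const_mul]
    congr 1
    ext z
    rw [resolvent]
    ring
  rw [h, resolvent, hk.fredholmMinor_eq lam hs x y]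
  field_simp

theorem BddContKernel.continuous_right (hk : BddContKernel k M) (x : ℝ) :
    Continuous fun y => k x y :=
  hk.cont.comp (continuous_const.prodMk continuous_id)

theorem BddContKernel.continuous_left (hk : BddContKernel k M) (y : ℝ) :
    Continuous fun x => k x y :=
  hk.cont.comp (continuous_id.prodMk continuous_const)

theorem BddContKernel.continuous_resolvent_right (hk : BddContKernel k M) (x : ℝ) :
    Continuous fun y => resolvent k lam s x y :=
  (hk.continuous_resolvent lam s).comp (continuous_const.prodMk continuous_id)

theorem BddContKernel.continuous_resolvent_left (hk : BddContKernel k M) (y : ℝ) :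
    Continuous fun x => resolvent k lam s x y :=
  (hk.continuous_resolvent lam s).comp (continuous_id.prodMk continuous_const)

/-- Solutions of `f = h + lam k f` are given by the resolvent. -/
theorem BddContKernel.eq_add_integral_resolvent (hk : BddContKernel k M)
    (hsym : ∀ x y, k x y = k y x) (hs : 0 < s) (hD : fredholmDet k 0 s lam ≠ 0)
    {f h : ℝ → ℝ} (hf : Continuous f)
    (hfh : ∀ x, f x = h x + lam * ∫ z in (0 : ℝ)..s, k x z * f z) (x : ℝ) :
    f x = h x + ∫ z in (0 : ℝ)..s, resolvent k lam s x z * h z := by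
  have hR := hk.continuous_resolvent lam s
  have hRx := hk.continuous_resolvent_right (lam := lam) (s := s) x
  have hkf : Continuous fun z => ∫ w in (0 : ℝ)..s, k z w * f w :=
    intervalIntegral.continuous_parametric_intervalIntegral_of_continuous'
      (hk.cont.mul (hf.comp continuous_snd)) _ _
  have h1 : ∀ z, h z = f z - lam * ∫ w in (0 : ℝ)..s, k z w * f w := fun z => by
    linarith [hfh z]
  -- By symmetry of both kernels the resolvent equation also reads `R (lam k) = R - lam k`. With `h
  -- = f - lam k f` this yields `R h = R f - (R - lam k) f = lam k f = f - h`.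
  have h2 : ∫ z in (0 : ℝ)..s, resolvent k lam s x z * (lam * ∫ w in (0 : ℝ)..s, k z w * f w) =
      ∫ w in (0 : ℝ)..s, (resolvent k lam s x w - lam * k x w) * f w := by
    simp only [← intervalIntegral.integral_const_mul]
    rw [intervalIntegral_swap]
    · refine intervalIntegral.integral_congr fun w _ => ?_
      have h3 := hk.resolvent_eq hs hD w x
      rw [resolvent_comm hsym w x, hsym w x] at h3
      rw [h3, add_sub_cancel_left, mul_assoc lam, ← intervalIntegral.integral_mul_const,
        ← intervalIntegral.integral_const_mul]
      refine intervalIntegral.integral_congr fun z _ => ?_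
      simp only [resolvent_comm hsym x z, hsym z w]
      ring
    · exact (hRx.comp continuous_fst).mul
        (continuous_const.mul (hk.cont.mul (hf.comp continuous_snd)))
  have h4 : ∫ z in (0 : ℝ)..s, resolvent k lam s x z * h z =
      (∫ z in (0 : ℝ)..s, resolvent k lam s x z * f z) -
      ∫ z in (0 : ℝ)..s, resolvent k lam s x z * (lam * ∫ w in (0 : ℝ)..s, k z w * f w) := by
    rw [← intervalIntegral.integral_sub]
    · refine intervalIntegral.integral_congr fun z _ => ?_
      simp only [h1 z]
      ring
    · exact (hRx.mul hf).intervalIntegrable _ _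
    · exact (hRx.mul (continuous_const.mul hkf)).intervalIntegrable _ _
  have h5 : ∫ w in (0 : ℝ)..s, (resolvent k lam s x w - lam * k x w) * f w =
      (∫ w in (0 : ℝ)..s, resolvent k lam s x w * f w) -
        lam * ∫ w in (0 : ℝ)..s, k x w * f w := by
    rw [← intervalIntegral.integral_const_mul, ← intervalIntegral.integral_sub]
    · refine intervalIntegral.integral_congr fun z _ => ?_
      ring
    · exact (hRx.mul hf).intervalIntegrable _ _
    · exact (continuous_const.mul ((hk.continuous_right x).mul hf)).intervalIntegrable _ _
  rw [h4, h2, h5, hfh x]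
  ring

theorem BddContKernel.resolvent_add_integral (hk : BddContKernel k M)
    (hsym : ∀ x y, k x y = k y x) (hs : 0 < s) (hD : fredholmDet k 0 s lam ≠ 0) (x y : ℝ) :
    lam * k x y + ∫ z in (0 : ℝ)..s, resolvent k lam s x z * (lam * k z y) =
      resolvent k lam s x y :=
  (hk.eq_add_integral_resolvent hsym hs hD (hk.continuous_resolvent_left y)
    (fun x => hk.resolvent_eq hs hD x y) x).symm

/-- A nonzero determinant makes the solution unique, so a resolvent can be recognised by its
integral equation. The reflection symmetry and the parity decomposition are both obtained in this
way. -/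
theorem BddContKernel.eq_resolvent (hk : BddContKernel k M)
    (hsym : ∀ x y, k x y = k y x) (hs : 0 < s) (hD : fredholmDet k 0 s lam ≠ 0)
    {f : ℝ → ℝ} (hf : Continuous f) (y : ℝ)
    (hfh : ∀ x, f x = lam * k x y + lam * ∫ z in (0 : ℝ)..s, k x z * f z) (x : ℝ) :
    f x = resolvent k lam s x y := by
  rw [hk.eq_add_integral_resolvent hsym hs hD hf hfh x, hk.resolvent_add_integral hsym hs hD]

/-- Dependence of the resolvent on the interval. -/
theorem BddContKernel.resolvent_sub (hk : BddContKernel k M)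
    (hsym : ∀ x y, k x y = k y x) (hs : 0 < s) (hD : fredholmDet k 0 s lam ≠ 0) {s' : ℝ}
    (hs' : 0 < s') (hD' : fredholmDet k 0 s' lam ≠ 0) (x y : ℝ) :
    resolvent k lam s' x y - resolvent k lam s x y =
      ∫ w in s..s', resolvent k lam s x w * resolvent k lam s' w y := by
  have hRx := hk.continuous_resolvent_right (lam := lam) (s := s) x
  have hRy := hk.continuous_resolvent_left (lam := lam) (s := s') y
  have hi : ∀ x a b, IntervalIntegrable (fun z => k x z * resolvent k lam s' z y) volume a b :=
    fun x a b => ((hk.continuous_right x).mul hRy).intervalIntegrable _ _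
  -- On `(0, s)` the resolvent for `s'` solves the equation whose source is enlarged by the
  -- contribution of the interval between `s` and `s'`.
  have h1 := hk.eq_add_integral_resolvent hsym hs hD (f := fun x => resolvent k lam s' x y)
    (h := fun x => lam * k x y + lam * ∫ z in s..s', k x z * resolvent k lam s' z y) hRy
    (fun x => by
      rw [hk.resolvent_eq hs' hD' x y,
        ← intervalIntegral.integral_add_adjacent_intervals (hi x 0 s) (hi x s s')]
      ring) x
  have hc : Continuous fun z => ∫ w in s..s', k z w * resolvent k lam s' w y :=
    intervalIntegral.continuous_parametric_intervalIntegral_of_continuous'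
      (hk.cont.mul (hRy.comp continuous_snd)) _ _
  have h2 : ∫ z in (0 : ℝ)..s, resolvent k lam s x z *
      (lam * k z y + lam * ∫ w in s..s', k z w * resolvent k lam s' w y) =
      (∫ z in (0 : ℝ)..s, resolvent k lam s x z * (lam * k z y)) +
      ∫ z in (0 : ℝ)..s, ∫ w in s..s',
        resolvent k lam s x z * (lam * k z w) * resolvent k lam s' w y := by
    rw [← intervalIntegral.integral_add]
    · refine intervalIntegral.integral_congr fun z _ => ?_
      rw [mul_add]
      congr 1
      rw [← mul_assoc, ← intervalIntegral.integral_const_mul]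
      refine intervalIntegral.integral_congr fun w _ => ?_
      ring
    · exact (hRx.mul (continuous_const.mul (hk.continuous_left y))).intervalIntegrable _ _
    · refine Continuous.intervalIntegrable ?_ _ _
      refine intervalIntegral.continuous_parametric_intervalIntegral_of_continuous' ?_ _ _
      exact ((hRx.comp continuous_fst).mul (continuous_const.mul hk.cont)).mul
        (hRy.comp continuous_snd)
  rw [intervalIntegral_swap] at h2
  swap
  · exact ((hRx.comp continuous_fst).mul (continuous_const.mul hk.cont)).mul
        (hRy.comp continuous_snd)
  have h3 : ∫ w in s..s', ∫ z in (0 : ℝ)..s,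
        resolvent k lam s x z * (lam * k z w) * resolvent k lam s' w y =
      (∫ w in s..s', resolvent k lam s x w * resolvent k lam s' w y) -
        lam * ∫ w in s..s', k x w * resolvent k lam s' w y := by
    rw [← intervalIntegral.integral_const_mul, ← intervalIntegral.integral_sub]
    · refine intervalIntegral.integral_congr fun w _ => ?_
      rw [intervalIntegral.integral_mul_const, ← hk.resolvent_add_integral hsym hs hD x w]
      ring
    · exact (hRx.mul hRy).intervalIntegrable _ _
    · exact (continuous_const.mul ((hk.continuous_right x).mul hRy)).intervalIntegrable _ _
  have h4 := hk.resolvent_add_integral hsym hs hD x y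
  rw [h2, h3] at h1
  linarith

theorem BddContKernel.continuousAt_resolvent (hk : BddContKernel k M) (hs : 0 < s)
    (hD : fredholmDet k 0 s lam ≠ 0) (x y : ℝ) :
    ContinuousAt (fun p : ℝ × ℝ × ℝ => resolvent k lam p.1 p.2.1 p.2.2) (s, x, y) := by
  refine ContinuousAt.div (continuousAt_const.mul (hk.continuous_fredholmMinor lam).continuousAt)
    ?_ hD
  exact ContinuousAt.comp (f := Prod.fst) (g := fun s => fredholmDet k 0 s lam) (x := (s, x, y))
    (hk.hasDerivAt_fredholmDet lam hs).continuousAt continuousAt_fst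

/-- The range of integration is empty at `s = c`, so continuity of `H` at `(c, c)` suffices and the
variation of the integrand with `s` is of lower order. -/
theorem hasDerivAt_integral_diag {H : ℝ → ℝ → ℝ} {c : ℝ}
    (hH : ContinuousAt (Function.uncurry H) (c, c)) (hi : ∀ s, Continuous (H s)) :
    HasDerivAt (fun s => ∫ w in c..s, H s w) (H c c) c := by
  rw [hasDerivAt_iff_isLittleO, Asymptotics.isLittleO_iff]
  intro ε hε
  obtain ⟨δ, hδ, h⟩ := Metric.continuousAt_iff.1 hH ε hε
  filter_upwards [Metric.ball_mem_nhds c hδ] with s hs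
  have hs' : |s - c| < δ := by simpa [Real.dist_eq] using hs
  have h1 : (∫ w in c..s, H s w) - (∫ w in c..c, H c w) - (s - c) • H c c =
      ∫ w in c..s, (H s w - H c c) := by
    rw [intervalIntegral.integral_sub ((hi s).intervalIntegrable _ _)
      intervalIntegrable_const]
    simp
  rw [h1, Real.norm_eq_abs (s - c)]
  refine intervalIntegral.norm_integral_le_of_norm_le_const fun w hw => ?_
  have hw' : |w - c| ≤ |s - c| := by
    rw [abs_sub_comm w, abs_sub_comm s]
    rw [Set.uIoc_comm] at hw
    exact Set.abs_sub_right_of_mem_uIcc (Set.uIoc_subset_uIcc hw)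
  have := h (x := (s, w)) (by
    rw [Prod.dist_eq, max_lt_iff]
    exact ⟨hs, by rw [Real.dist_eq]; exact hw'.trans_lt hs'⟩)
  rw [Real.dist_eq] at this
  exact this.le

/-- The derivative of the resolvent with respect to the length of the interval. -/
theorem BddContKernel.hasDerivAt_resolvent (hk : BddContKernel k M)
    (hsym : ∀ x y, k x y = k y x) (hs : 0 < s) (hD : fredholmDet k 0 s lam ≠ 0) (x y : ℝ) :
    HasDerivAt (fun s' => resolvent k lam s' x y)
      (resolvent k lam s x s * resolvent k lam s s y) s := by
  have h1 : HasDerivAt (fun s' => ∫ w in s..s', resolvent k lam s x w * resolvent k lam s' w y)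
      (resolvent k lam s x s * resolvent k lam s s y) s := by
    refine hasDerivAt_integral_diag
      (H := fun s' w => resolvent k lam s x w * resolvent k lam s' w y) ?_ fun s' =>
      (hk.continuous_resolvent_right x).mul (hk.continuous_resolvent_left y)
    refine ContinuousAt.mul
      ((hk.continuous_resolvent_right x).continuousAt.comp continuousAt_snd) ?_
    exact ContinuousAt.comp (f := fun p : ℝ × ℝ => (p.1, p.2, y))
      (g := fun p : ℝ × ℝ × ℝ => resolvent k lam p.1 p.2.1 p.2.2) (x := (s, s))
      (hk.continuousAt_resolvent hs hD s y) (by fun_prop)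
  refine (h1.const_add (resolvent k lam s x y)).congr_of_eventuallyEq ?_
  filter_upwards [lt_mem_nhds hs,
    (hk.hasDerivAt_fredholmDet lam hs).continuousAt.eventually_ne hD] with s' hs' hD'
  linarith [hk.resolvent_sub hsym hs hD hs' hD' x y]

theorem BddContKernel.hasDerivAt_fredholmDet' (hk : BddContKernel k M) (hs : 0 < s)
    (hD : fredholmDet k 0 s lam ≠ 0) : HasDerivAt (fun x => fredholmDet k 0 x lam)
      (-resolvent k lam s s s * fredholmDet k 0 s lam) s := by
  convert hk.hasDerivAt_fredholmDet lam hs using 1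
  rw [resolvent]
  field_simp

end

/-! ### The sine kernel, its even and odd parts, and the edge values of its resolvent. -/

theorem sineKernel_comm (x y : ℝ) : sineKernel x y = sineKernel y x := by
  rw [sineKernel, sineKernel, ← Real.sinc_neg]
  congr 1
  ring

theorem sineKernel_eq_of_sub_eq {x y x' y' : ℝ} (h : x - y = x' - y') :
    sineKernel x y = sineKernel x' y' := by
  rw [sineKernel, sineKernel, h]

theorem sineKernel_self (x : ℝ) : sineKernel x x = 1 := by
  simp [sineKernel]

theorem continuous_sineKernel : Continuous fun p : ℝ × ℝ => sineKernel p.1 p.2 :=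
  Real.continuous_sinc.comp (by fun_prop)

theorem abs_sineKernel_le (x y : ℝ) : |sineKernel x y| ≤ 1 := Real.abs_sinc_le_one _

theorem bddContKernel_sineKernel : BddContKernel sineKernel 1 :=
  ⟨continuous_sineKernel, le_rfl, abs_sineKernel_le⟩

/-- The kernels of the even (`ε = 1`) and odd (`ε = -1`) parts of the sine kernel. -/
noncomputable def parityKernel (ε x y : ℝ) : ℝ := sineKernel x y + ε * sineKernel (-x) y

theorem parityKernel_comm (ε x y : ℝ) : parityKernel ε x y = parityKernel ε y x := by
  rw [parityKernel, parityKernel, sineKernel_comm x y, sineKernel_comm (-x) y,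
    sineKernel_eq_of_sub_eq (show y - -x = x - -y by ring), sineKernel_comm x]

theorem bddContKernel_parityKernel {ε : ℝ} (hε : |ε| = 1) :
    BddContKernel (parityKernel ε) 2 := by
  refine ⟨?_, one_le_two, fun x y => ?_⟩
  · exact continuous_sineKernel.add (continuous_const.mul
      (continuous_sineKernel.comp (continuous_fst.neg.prodMk continuous_snd)))
  · calc |parityKernel ε x y| ≤ |sineKernel x y| + |ε * sineKernel (-x) y| := abs_add_le _ _
      _ ≤ 1 + 1 * 1 := by
        rw [abs_mul, hε]
        gcongr <;> exact abs_sineKernel_le _ _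
      _ = 2 := by norm_num

theorem fredholmDet_translate (k : ℝ → ℝ → ℝ) (c : ℝ) (hk : ∀ x y, k (x + c) (y + c) = k x y)
    (a b lam : ℝ) : fredholmDet k (a + c) (b + c) lam = fredholmDet k a b lam := by
  refine tsum_congr fun n => ?_
  congr 1
  have hmp := measurePreserving_add_right (volume : Measure (Fin n → ℝ)) (fun _ => c)
  rw [← hmp.setIntegral_preimage_emb (measurableEmbedding_addRight _)]
  have : (fun x : Fin n → ℝ => x + fun _ => c) ⁻¹'
      (Set.univ.pi fun _ => Set.Ioo (a + c) (b + c)) = Set.univ.pi fun _ => Set.Ioo a b := by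
    ext p
    simp
  rw [this]
  simp only [Pi.add_apply, hk]

/-- Translation invariance fixes the left endpoint at `0`, so that only one endpoint moves with `s`.
-/
theorem D_eq_fredholmDet (s lam : ℝ) : D s lam = fredholmDet sineKernel 0 s lam := by
  rw [D, ← fredholmDet_translate sineKernel (-(s / 2))
    (fun x y => sineKernel_eq_of_sub_eq (by ring)) 0 s lam]
  congr 1 <;> ring

theorem Dplus_eq_fredholmDet (s lam : ℝ) :
    Dplus s lam = fredholmDet (parityKernel 1) 0 (s / 2) lam := by
  simp only [Dplus, funext₂ (parityKernel.eq_1 1), one_mul]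

theorem Dminus_eq_fredholmDet (s lam : ℝ) :
    Dminus s lam = fredholmDet (parityKernel (-1)) 0 (s / 2) lam := by
  simp only [Dminus, funext₂ (parityKernel.eq_1 (-1)), neg_one_mul, ← sub_eq_add_neg]

/-- The entire extension of `sinc`. -/
noncomputable def complexSinc : ℂ → ℂ := dslope Complex.sin 0

theorem differentiable_complexSinc : Differentiable ℂ complexSinc := by
  have h := (Complex.differentiableOn_dslope (f := Complex.sin) (s := Set.univ) (c := 0)
    Filter.univ_mem).2 Complex.differentiable_sin.differentiableOn
  exact differentiableOn_univ.1 h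

theorem complexSinc_ofReal (x : ℝ) : complexSinc x = Real.sinc x := by
  rw [complexSinc]
  by_cases hx : x = 0
  · simp [hx]
  · rw [dslope_of_ne _ (by exact_mod_cast hx), Real.sinc_of_ne_zero hx, slope_def_field]
    simp

/-- `D` is constant for negative `s`, so the continuation agrees with it only for `s ≥ 0`. It makes
the identity theorem and analyticity in `s` available. -/
theorem exists_entire_D (lam : ℝ) :
    ∃ E : ℂ → ℂ, Differentiable ℂ E ∧ ∀ s : ℝ, 0 ≤ s → E s = D s lam := by
  obtain ⟨E, hE, h⟩ := bddContKernel_sineKernel.exists_entire_fredholmDet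
    (κ := fun z w => complexSinc (Real.pi * (z - w)))
    (differentiable_complexSinc.continuous.comp (by fun_prop))
    (fun u v => differentiable_complexSinc.comp (by fun_prop))
    (fun x y => by
      rw [sineKernel, ← complexSinc_ofReal]
      push_cast
      rfl) lam
  exact ⟨E, hE, fun s hs => by rw [h s hs, D_eq_fredholmDet]⟩

theorem exists_entire_parity {ε : ℝ} (hε : |ε| = 1) (lam : ℝ) :
    ∃ E : ℂ → ℂ, Differentiable ℂ E ∧
      ∀ s : ℝ, 0 ≤ s → E s = fredholmDet (parityKernel ε) 0 (s / 2) lam := by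
  obtain ⟨E, hE, h⟩ := (bddContKernel_parityKernel hε).exists_entire_fredholmDet
    (κ := fun z w => complexSinc (Real.pi * (z - w)) + ε * complexSinc (Real.pi * (-z - w)))
    ((differentiable_complexSinc.continuous.comp (by fun_prop)).add
      (continuous_const.mul (differentiable_complexSinc.continuous.comp (by fun_prop))))
    (fun u v => (differentiable_complexSinc.comp (by fun_prop)).add
      ((differentiable_complexSinc.comp (by fun_prop)).const_mul _))
    (fun x y => by
      rw [parityKernel, sineKernel, sineKernel]
      push_cast [← complexSinc_ofReal]
      rfl) lam
  refine ⟨fun z => E (z / 2), hE.comp (by fun_prop), fun s hs => ?_⟩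
  rw [← h (s / 2) (by positivity)]
  push_cast
  rfl

/-- The resolvent kernel `R(0, 0)` of `lam K` on `(0, s)`. -/
noncomputable def edgeDiag (lam s : ℝ) : ℝ := resolvent sineKernel lam s 0 0

/-- The resolvent kernel `R(0, s)` of `lam K` on `(0, s)`. -/
noncomputable def edgeCross (lam s : ℝ) : ℝ := resolvent sineKernel lam s 0 s

theorem D_zero (lam : ℝ) : D 0 lam = 1 := by
  rw [D_eq_fredholmDet, bddContKernel_sineKernel.fredholmDet_zero]

theorem continuousOn_D (lam : ℝ) : ContinuousOn (fun s => D s lam) (Set.Ici 0) := by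
  simp only [D_eq_fredholmDet]
  exact bddContKernel_sineKernel.continuousOn_fredholmDet lam

theorem edgeDiag_zero (lam : ℝ) : edgeDiag lam 0 = lam := by
  rw [edgeDiag, resolvent, fredholmMinor_zero, bddContKernel_sineKernel.fredholmDet_zero,
    sineKernel_self, mul_one, div_one]

/-- For an interval of length `0` the two edge values coincide. The initial value `lam` of the
square root comes from here. -/
theorem edgeCross_zero (lam : ℝ) : edgeCross lam 0 = lam := edgeDiag_zero lam

theorem continuousOn_edgeDiag {lam : ℝ} {S : Set ℝ} (hS : S ⊆ Set.Ici 0)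
    (hD : ∀ s ∈ S, D s lam ≠ 0) : ContinuousOn (edgeDiag lam) S := by
  simp only [D_eq_fredholmDet] at hD
  refine ContinuousOn.div (continuousOn_const.mul ?_)
    ((bddContKernel_sineKernel.continuousOn_fredholmDet lam).mono hS) hD
  exact ((bddContKernel_sineKernel.continuous_fredholmMinor lam).comp
    (continuous_id.prodMk (continuous_const.prodMk continuous_const))).continuousOn

theorem continuousOn_edgeCross {lam : ℝ} {S : Set ℝ} (hS : S ⊆ Set.Ici 0)
    (hD : ∀ s ∈ S, D s lam ≠ 0) : ContinuousOn (edgeCross lam) S := by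
  simp only [D_eq_fredholmDet] at hD
  refine ContinuousOn.div (continuousOn_const.mul ?_)
    ((bddContKernel_sineKernel.continuousOn_fredholmDet lam).mono hS) hD
  exact ((bddContKernel_sineKernel.continuous_fredholmMinor lam).comp
    (continuous_id.prodMk (continuous_const.prodMk continuous_id))).continuousOn

section

variable {lam s : ℝ}

/-- The reflection `x ↦ s - x` preserves both the interval and the kernel, so the two sides solve
the same integral equation. -/
theorem resolvent_reflect (hs : 0 < s) (hD : D s lam ≠ 0) (x y : ℝ) :
    resolvent sineKernel lam s (s - x) (s - y) = resolvent sineKernel lam s x y := by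
  rw [D_eq_fredholmDet] at hD
  have hk := bddContKernel_sineKernel
  refine hk.eq_resolvent sineKernel_comm hs hD
    (f := fun x => resolvent sineKernel lam s (s - x) (s - y))
    ((hk.continuous_resolvent_left (s - y)).comp (by fun_prop)) y (fun x => ?_) x
  rw [hk.resolvent_eq hs hD, sineKernel_comm x y,
    sineKernel_eq_of_sub_eq (show s - x - (s - y) = y - x by ring)]
  congr 2
  have h := intervalIntegral.integral_comp_sub_left (a := 0) (b := s)
    (fun z => sineKernel (s - x) z * resolvent sineKernel lam s z (s - y)) s
  rw [sub_self, sub_zero] at h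
  rw [← h]
  refine intervalIntegral.integral_congr fun z _ => ?_
  rw [sineKernel_comm x z, sineKernel_eq_of_sub_eq (show s - x - (s - z) = z - x by ring)]

theorem resolvent_self_eq_edgeDiag (hs : 0 < s) (hD : D s lam ≠ 0) :
    resolvent sineKernel lam s s s = edgeDiag lam s := by
  have := resolvent_reflect hs hD 0 0
  rwa [sub_zero] at this

/-- The derivative is `R(0, s) R(s, 0)`, and symmetry makes it a perfect square. This is the source
of the square root in the theorem. -/
theorem hasDerivAt_edgeDiag (hs : 0 < s) (hD : D s lam ≠ 0) :
    HasDerivAt (edgeDiag lam) (edgeCross lam s ^ 2) s := by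
  rw [D_eq_fredholmDet] at hD
  have h := bddContKernel_sineKernel.hasDerivAt_resolvent sineKernel_comm hs hD 0 0
  rw [resolvent_comm sineKernel_comm s 0, ← sq] at h
  exact h

theorem hasDerivAt_D (hs : 0 < s) (hD : D s lam ≠ 0) :
    HasDerivAt (fun x => D x lam) (-edgeDiag lam s * D s lam) s := by
  rw [← resolvent_self_eq_edgeDiag hs hD]
  simp only [D_eq_fredholmDet] at hD ⊢
  exact bddContKernel_sineKernel.hasDerivAt_fredholmDet' hs hD

/-- The resolvents of the even and odd parts in terms of the resolvent of the sine kernel. -/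
theorem resolvent_parityKernel {ε t : ℝ} (hε : |ε| = 1) (ht : 0 < t) (hD : D (2 * t) lam ≠ 0)
    (hDε : fredholmDet (parityKernel ε) 0 t lam ≠ 0) (x y : ℝ) :
    resolvent (parityKernel ε) lam t x y = resolvent sineKernel lam (2 * t) (t + x) (t + y) +
      ε * resolvent sineKernel lam (2 * t) (t - x) (t + y) := by
  rw [D_eq_fredholmDet] at hD
  have hk := bddContKernel_sineKernel
  have hc := hk.continuous_resolvent_left (lam := lam) (s := 2 * t) (t + y)
  have hc1 : Continuous fun x => resolvent sineKernel lam (2 * t) (t + x) (t + y) :=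
    hc.comp (continuous_const.add continuous_id)
  have hc2 : Continuous fun x => resolvent sineKernel lam (2 * t) (t - x) (t + y) :=
    hc.comp (continuous_const.sub continuous_id)
  have hkε := bddContKernel_parityKernel hε
  have hε2 : ε * ε = 1 := by rw [← abs_mul_abs_self, hε, one_mul]
  refine (hkε.eq_resolvent (parityKernel_comm ε) ht hDε
    (f := fun x => resolvent sineKernel lam (2 * t) (t + x) (t + y) +
      ε * resolvent sineKernel lam (2 * t) (t - x) (t + y))
    (hc1.add (continuous_const.mul hc2)) y (fun x => ?_) x).symm
  have hi : ∀ x a b, IntervalIntegrable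
      (fun z => sineKernel x z * resolvent sineKernel lam (2 * t) z (t + y)) volume a b :=
    fun x a b => ((hk.continuous_right x).mul hc).intervalIntegrable _ _
  -- Combining the resolvent equations at `t + x` and `t - x`, with the interval recentred at its
  -- midpoint `t`, produces the parity kernel.
  have h1 : (∫ z in (0 : ℝ)..2 * t,
        sineKernel (t + x) z * resolvent sineKernel lam (2 * t) z (t + y)) +
      ε * (∫ z in (0 : ℝ)..2 * t,
        sineKernel (t - x) z * resolvent sineKernel lam (2 * t) z (t + y)) =
      ∫ v in (-t)..t, parityKernel ε x v * resolvent sineKernel lam (2 * t) (t + v) (t + y) := by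
    rw [← intervalIntegral.integral_const_mul,
      ← intervalIntegral.integral_add (hi _ _ _) ((hi _ _ _).const_mul ε)]
    have h := intervalIntegral.integral_comp_add_left (a := -t) (b := t) (fun z =>
      sineKernel (t + x) z * resolvent sineKernel lam (2 * t) z (t + y) +
      ε * (sineKernel (t - x) z * resolvent sineKernel lam (2 * t) z (t + y))) t
    rw [add_neg_cancel, ← two_mul] at h
    rw [← h]
    refine intervalIntegral.integral_congr fun v _ => ?_
    rw [parityKernel, sineKernel_eq_of_sub_eq (show t + x - (t + v) = x - v by ring),
      sineKernel_eq_of_sub_eq (show t - x - (t + v) = -x - v by ring)]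
    ring
  have hp : ∀ a b, IntervalIntegrable
      (fun v => parityKernel ε x v * resolvent sineKernel lam (2 * t) (t + v) (t + y))
      volume a b := fun a b => ((hkε.continuous_right x).mul hc1).intervalIntegrable _ _
  -- The parity kernel is multiplied by `ε` under `v ↦ -v`, so the integral folds onto `(0, t)`.
  have h2 : ∫ v in (-t)..t,
      parityKernel ε x v * resolvent sineKernel lam (2 * t) (t + v) (t + y) =
      ∫ v in (0 : ℝ)..t, parityKernel ε x v *
        (resolvent sineKernel lam (2 * t) (t + v) (t + y) +
          ε * resolvent sineKernel lam (2 * t) (t - v) (t + y)) := by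
    rw [← intervalIntegral.integral_add_adjacent_intervals (hp (-t) 0) (hp 0 t)]
    have h := intervalIntegral.integral_comp_neg (a := 0) (b := t)
      (fun v => parityKernel ε x v * resolvent sineKernel lam (2 * t) (t + v) (t + y))
    rw [neg_zero] at h
    rw [← h, ← intervalIntegral.integral_add]
    · refine intervalIntegral.integral_congr fun v _ => ?_
      have h3 : parityKernel ε x (-v) = ε * parityKernel ε x v := by
        rw [parityKernel, parityKernel,
          sineKernel_eq_of_sub_eq (show x - -v = v - -x by ring), sineKernel_comm v,
          sineKernel_eq_of_sub_eq (show -x - -v = v - x by ring), sineKernel_comm v]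
        linear_combination -sineKernel (-x) v * hε2
      rw [h3, ← sub_eq_add_neg]
      ring
    · exact ((hkε.continuous_right x).comp continuous_neg |>.mul
        (hc1.comp continuous_neg)).intervalIntegrable _ _
    · exact hp 0 t
  rw [← h2, ← h1]
  rw [hk.resolvent_eq (by positivity) hD (t + x), hk.resolvent_eq (by positivity) hD (t - x),
    parityKernel, sineKernel_eq_of_sub_eq (show t + x - (t + y) = x - y by ring),
    sineKernel_eq_of_sub_eq (show t - x - (t + y) = -x - y by ring)]
  ring

/-- At `x = y = t = s / 2` the parity resolvent is `R(s, s) + ε R(0, s)`; the half interval grows at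
rate `1 / 2`. -/
theorem hasDerivAt_parity {ε : ℝ} (hε : |ε| = 1) (hs : 0 < s) (hD : D s lam ≠ 0)
    (hDε : fredholmDet (parityKernel ε) 0 (s / 2) lam ≠ 0) :
    HasDerivAt (fun x => fredholmDet (parityKernel ε) 0 (x / 2) lam)
      (-(edgeDiag lam s + ε * edgeCross lam s) / 2 * fredholmDet (parityKernel ε) 0 (s / 2) lam)
      s := by
  have h2 : 2 * (s / 2) = s := by ring
  have h := (bddContKernel_parityKernel hε).hasDerivAt_fredholmDet' (half_pos hs) hDε
  rw [resolvent_parityKernel hε (half_pos hs) (by rwa [h2]) hDε, h2, add_halves, sub_self,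
    resolvent_self_eq_edgeDiag hs hD] at h
  have h3 := h.comp s ((hasDerivAt_id s).div_const 2)
  refine HasDerivAt.congr_deriv h3 ?_
  rw [show edgeCross lam s = resolvent sineKernel lam s 0 s from rfl]
  ring

end

/-! ### Plancherel's theorem and band-limited functions. -/

open scoped FourierTransform ComplexConjugate ContDiff SchwartzMap

/-- The `L²` Fourier transform agrees with the Fourier integral on `L¹ ∩ L²`. -/
theorem toLp_fourier_ae_eq {f : ℝ → ℂ} (hf : Integrable f) (hf2 : MemLp f 2) :
    ((𝓕 (hf2.toLp f) : Lp ℂ 2 (volume : Measure ℝ)) : ℝ → ℂ) =ᵐ[volume] 𝓕 f := by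
  have hcont : Continuous (𝓕 f) := VectorFourier.fourierIntegral_continuous
    Real.continuous_fourierChar (by exact continuous_inner) hf
  refine ae_eq_of_integral_contDiff_smul_eq ?_ hcont.locallyIntegrable fun g hg hgs => ?_
  · exact (Lp.memLp _).locallyIntegrable (by norm_num)
  have hgs' : HasCompactSupport fun x => (g x : ℂ) := hgs.comp_left (g := Complex.ofReal) rfl
  let φ : 𝓢(ℝ, ℂ) := hgs'.toSchwartzMap (Complex.ofRealCLM.contDiff.comp hg)
  have hφ : ∀ x, φ x = (g x : ℂ) := fun x => rfl
  -- Tested against smooth compactly supported functions, the `L²` transform is the distributional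
  -- one; the multiplication formula moves it onto `f`.
  have h1 := DFunLike.congr_fun (Lp.fourier_toTemperedDistribution_eq (hf2.toLp f)) φ
  rw [TemperedDistribution.fourier_apply, Lp.toTemperedDistribution_apply,
    Lp.toTemperedDistribution_apply] at h1
  have h2 : ∫ x, (𝓕 φ) x • (hf2.toLp f : ℝ → ℂ) x = ∫ x, (𝓕 φ) x • f x := by
    refine integral_congr_ae ?_
    filter_upwards [hf2.coeFn_toLp] with x hx
    rw [hx]
  have h3 : ∫ x, (𝓕 φ) x • f x = ∫ x, φ x • (𝓕 f) x := by
    have := VectorFourier.integral_fourierIntegral_smul_eq_flip (μ := volume) (ν := volume)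
      (L := innerₗ ℝ) (f := φ) (g := f) Real.continuous_fourierChar
      (by exact continuous_inner) φ.integrable hf
    rw [flip_innerₗ] at this
    rw [SchwartzMap.fourier_coe]
    exact this
  rw [h2, h3] at h1
  simp only [hφ, smul_eq_mul] at h1
  simp only [Complex.real_smul]
  exact h1.symm

/-- **Plancherel's theorem** for functions in `L¹ ∩ L²`. -/
theorem integral_conj_fourier_mul_fourier {f g : ℝ → ℂ} (hf : Integrable f) (hf2 : MemLp f 2)
    (hg : Integrable g) (hg2 : MemLp g 2) :
    Integrable (fun x => conj (𝓕 f x) * 𝓕 g x) ∧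
      ∫ x, conj (𝓕 f x) * 𝓕 g x = ∫ x, conj (f x) * g x := by
  have h1 := Lp.inner_fourier_eq (hf2.toLp f) (hg2.toLp g)
  rw [L2.inner_def, L2.inner_def] at h1
  have e1 : (fun x => inner ℂ ((𝓕 (hf2.toLp f) : Lp ℂ 2 (volume : Measure ℝ)) x)
      ((𝓕 (hg2.toLp g) : Lp ℂ 2 (volume : Measure ℝ)) x)) =ᵐ[volume]
      fun x => conj (𝓕 f x) * 𝓕 g x := by
    filter_upwards [toLp_fourier_ae_eq hf hf2, toLp_fourier_ae_eq hg hg2] with x hx hx'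
    rw [hx, hx', RCLike.inner_apply, mul_comm]
  have e2 : (fun x => inner ℂ ((hf2.toLp f : ℝ → ℂ) x) ((hg2.toLp g : ℝ → ℂ) x)) =ᵐ[volume]
      fun x => conj (f x) * g x := by
    filter_upwards [hf2.coeFn_toLp, hg2.coeFn_toLp] with x hx hx'
    rw [hx, hx', RCLike.inner_apply, mul_comm]
  rw [integral_congr_ae e1, integral_congr_ae e2] at h1
  exact ⟨(L2.integrable_inner _ _).congr e1, h1⟩

/-- The band-limited function with spectral density `U` on `[-1/2, 1/2]`. -/
noncomputable def bandlimited (U : ℝ → ℂ) (x : ℝ) : ℂ :=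
  ∫ k in (-(1 / 2) : ℝ)..1 / 2, Complex.exp (-(2 * Real.pi * k * x * Complex.I)) * U k

theorem bandlimited_eq_fourier (U : ℝ → ℂ) (x : ℝ) :
    bandlimited U x = 𝓕 (Set.indicator (Set.Ioc (-(1 / 2) : ℝ) (1 / 2)) U) x := by
  rw [Real.fourier_eq', bandlimited, intervalIntegral.integral_of_le (by norm_num),
    ← integral_indicator measurableSet_Ioc]
  congr 1
  ext k
  by_cases hk : k ∈ Set.Ioc (-(1 / 2) : ℝ) (1 / 2)
  · simp only [Set.indicator_of_mem hk, smul_eq_mul]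
    congr 2
    simp
    ring
  · simp only [Set.indicator_of_notMem hk, smul_zero]

theorem memLp_indicator_band {U : ℝ → ℂ} (hU : Continuous U) (p : ENNReal) :
    MemLp (Set.indicator (Set.Ioc (-(1 / 2) : ℝ) (1 / 2)) U) p := by
  obtain ⟨C, hC⟩ := (isCompact_Icc (a := (-(1 / 2) : ℝ)) (b := 1 / 2)).exists_bound_of_continuousOn
    hU.continuousOn
  rw [memLp_indicator_iff_restrict measurableSet_Ioc]
  refine MemLp.of_bound hU.aestronglyMeasurable C ?_
  filter_upwards [ae_restrict_mem measurableSet_Ioc] with x hx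
  exact hC x (Set.Ioc_subset_Icc_self hx)

/-- Plancherel's theorem for band-limited functions. -/
theorem integral_conj_bandlimited_mul {U V : ℝ → ℂ} (hU : Continuous U) (hV : Continuous V) :
    Integrable (fun x => conj (bandlimited U x) * bandlimited V x) ∧
      ∫ x, conj (bandlimited U x) * bandlimited V x =
        ∫ k in (-(1 / 2) : ℝ)..1 / 2, conj (U k) * V k := by
  have h := integral_conj_fourier_mul_fourier
    (memLp_one_iff_integrable.1 (memLp_indicator_band hU 1)) (memLp_indicator_band hU 2)
    (memLp_one_iff_integrable.1 (memLp_indicator_band hV 1)) (memLp_indicator_band hV 2)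
  simp only [← bandlimited_eq_fourier] at h
  refine ⟨h.1, h.2.trans ?_⟩
  rw [intervalIntegral.integral_of_le (by norm_num), ← integral_indicator measurableSet_Ioc]
  congr 1
  ext k
  by_cases hk : k ∈ Set.Ioc (-(1 / 2) : ℝ) (1 / 2)
  · simp only [Set.indicator_of_mem hk]
  · simp only [Set.indicator_of_notMem hk, mul_zero]

/-- The sine kernel is the inverse transform of the indicator of the band `[-1/2, 1/2]`, so its
convolution operator on the line is the projection onto band-limited functions. -/
theorem sineKernel_eq_bandlimited (x y : ℝ) : (sineKernel x y : ℂ) =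
    bandlimited (fun k => Complex.exp (2 * Real.pi * k * y * Complex.I)) x := by
  have h : ∀ k : ℝ, Complex.exp (-(2 * Real.pi * k * x * Complex.I)) *
      Complex.exp (2 * Real.pi * k * y * Complex.I) =
      Complex.exp ((-2 * Real.pi * (x - y) * Complex.I) * k) := by
    intro k
    rw [← Complex.exp_add]
    congr 1
    ring
  simp only [bandlimited, h]
  rw [sineKernel]
  by_cases hxy : x - y = 0
  · have : (x : ℂ) - y = 0 := by exact_mod_cast hxy
    rw [hxy, this]
    norm_num
  have hxy' : (x : ℂ) - y ≠ 0 := by exact_mod_cast hxy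
  have hpi : (Real.pi : ℂ) ≠ 0 := by exact_mod_cast Real.pi_ne_zero
  rw [integral_exp_mul_complex (by simp [hxy', hpi, Complex.I_ne_zero]),
    Real.sinc_of_ne_zero (mul_ne_zero Real.pi_ne_zero hxy)]
  push_cast
  rw [Complex.sin]
  have e1 : -2 * (Real.pi : ℂ) * (x - y) * Complex.I * (1 / 2) =
    -(Real.pi * (x - y)) * Complex.I := by ring
  have e2 : -2 * (Real.pi : ℂ) * (x - y) * Complex.I * (-(1 / 2)) =
    (Real.pi * (x - y)) * Complex.I := by ring
  rw [e1, e2]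
  field_simp
  rw [Complex.I_sq]
  ring

section

variable {lam s : ℝ} {g : ℝ → ℝ}

/-- The spectral density of a solution of `g = lam K (g 1_{(0, s)} + δ_s)`. -/
noncomputable def spectralDensity (lam s : ℝ) (g : ℝ → ℝ) (k : ℝ) : ℂ :=
  lam * ((∫ y in (0 : ℝ)..s, Complex.exp (2 * Real.pi * k * y * Complex.I) * g y) +
    Complex.exp (2 * Real.pi * k * s * Complex.I))

theorem continuous_spectralDensity (hg : Continuous g) :
    Continuous (spectralDensity lam s g) := by
  refine continuous_const.mul (Continuous.add ?_ (by fun_prop))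
  refine intervalIntegral.continuous_parametric_intervalIntegral_of_continuous' ?_ _ _
  exact Continuous.mul (by fun_prop) (Complex.continuous_ofReal.comp (hg.comp continuous_snd))

theorem eq_bandlimited (hg : Continuous g)
    (h : ∀ x, g x = lam * sineKernel x s + lam * ∫ y in (0 : ℝ)..s, sineKernel x y * g y)
    (x : ℝ) : (g x : ℂ) = bandlimited (spectralDensity lam s g) x := by
  have hgc : Continuous fun y => (g y : ℂ) := Complex.continuous_ofReal.comp hg
  have h1 : bandlimited (spectralDensity lam s g) x =
      lam * ((∫ k in (-(1 / 2) : ℝ)..1 / 2, ∫ y in (0 : ℝ)..s,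
        Complex.exp (-(2 * Real.pi * k * x * Complex.I)) *
          (Complex.exp (2 * Real.pi * k * y * Complex.I) * g y)) + sineKernel x s) := by
    rw [sineKernel_eq_bandlimited, bandlimited, bandlimited, ← intervalIntegral.integral_add,
      ← intervalIntegral.integral_const_mul]
    · refine intervalIntegral.integral_congr fun k _ => ?_
      simp only [spectralDensity, intervalIntegral.integral_const_mul]
      ring
    · refine Continuous.intervalIntegrable ?_ _ _
      refine intervalIntegral.continuous_parametric_intervalIntegral_of_continuous' ?_ _ _
      exact Continuous.mul (by fun_prop)
        (Continuous.mul (by fun_prop) (hgc.comp continuous_snd))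
    · exact Continuous.intervalIntegrable (by fun_prop) _ _
  rw [h1, intervalIntegral_swap, h x]
  · have h2 : ∀ y : ℝ, ∫ k in (-(1 / 2) : ℝ)..1 / 2,
        Complex.exp (-(2 * Real.pi * k * x * Complex.I)) *
          (Complex.exp (2 * Real.pi * k * y * Complex.I) * g y) =
        ((sineKernel x y * g y : ℝ) : ℂ) := by
      intro y
      push_cast
      rw [sineKernel_eq_bandlimited, bandlimited, ← intervalIntegral.integral_mul_const]
      refine intervalIntegral.integral_congr fun k _ => ?_
      simp only [mul_assoc]
    simp only [h2]
    rw [intervalIntegral.integral_ofReal]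
    push_cast
    ring
  · exact Continuous.mul (by fun_prop)
        (Continuous.mul (by fun_prop) (hgc.comp continuous_snd))

/-- Pairing of a solution of `g = lam K (g 1_{(0, s)} + δ_s)` with a band-limited function. -/
theorem integral_mul_bandlimited (hg : Continuous g)
    (h : ∀ x, g x = lam * sineKernel x s + lam * ∫ y in (0 : ℝ)..s, sineKernel x y * g y)
    {V : ℝ → ℂ} (hV : Continuous V) :
    Integrable (fun x => (g x : ℂ) * bandlimited V x) ∧
      ∫ x, (g x : ℂ) * bandlimited V x =
        lam * ((∫ y in (0 : ℝ)..s, (g y : ℂ) * bandlimited V y) + bandlimited V s) := by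
  have hgc : Continuous fun y => (g y : ℂ) := Complex.continuous_ofReal.comp hg
  have h0 := integral_conj_bandlimited_mul (continuous_spectralDensity (lam := lam) (s := s) hg) hV
  simp only [← eq_bandlimited hg h, Complex.conj_ofReal] at h0
  refine ⟨h0.1, h0.2.trans ?_⟩
  have hconj : ∀ k : ℝ, conj (spectralDensity lam s g k) =
      lam * ((∫ y in (0 : ℝ)..s, Complex.exp (-(2 * Real.pi * k * y * Complex.I)) * g y) +
        Complex.exp (-(2 * Real.pi * k * s * Complex.I))) := by
    intro k
    have he : ∀ y : ℝ, conj (Complex.exp (2 * Real.pi * k * y * Complex.I)) =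
        Complex.exp (-(2 * Real.pi * k * y * Complex.I)) := by
      intro y
      rw [← Complex.exp_conj]
      congr 1
      have h2 : conj (2 : ℂ) = 2 := Complex.conj_eq_iff_real.2 ⟨2, by norm_num⟩
      simp [Complex.conj_ofReal, h2]
    rw [spectralDensity, map_mul, map_add, he, Complex.conj_ofReal,
      ← intervalIntegral.intervalIntegral_conj]
    simp only [map_mul, he, Complex.conj_ofReal]
  have h1 : ∫ k in (-(1 / 2) : ℝ)..1 / 2, conj (spectralDensity lam s g k) * V k =
      lam * ((∫ k in (-(1 / 2) : ℝ)..1 / 2, ∫ y in (0 : ℝ)..s,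
        (g y : ℂ) * (Complex.exp (-(2 * Real.pi * k * y * Complex.I)) * V k)) +
        bandlimited V s) := by
    rw [bandlimited, ← intervalIntegral.integral_add, ← intervalIntegral.integral_const_mul]
    · refine intervalIntegral.integral_congr fun k _ => ?_
      have h2 : ∀ y : ℝ, (g y : ℂ) * (Complex.exp (-(2 * Real.pi * k * y * Complex.I)) * V k) =
          (Complex.exp (-(2 * Real.pi * k * y * Complex.I)) * g y) * V k := fun y => by ring
      simp only [hconj, h2, intervalIntegral.integral_mul_const]
      ring
    · refine Continuous.intervalIntegrable ?_ _ _
      refine intervalIntegral.continuous_parametric_intervalIntegral_of_continuous' ?_ _ _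
      exact Continuous.mul (hgc.comp continuous_snd)
        (Continuous.mul (by fun_prop) (hV.comp continuous_fst))
    · exact Continuous.intervalIntegrable (Continuous.mul (by fun_prop) hV) _ _
  rw [h1, intervalIntegral_swap]
  · simp only [intervalIntegral.integral_const_mul]
    rfl
  · exact Continuous.mul (hgc.comp continuous_snd)
        (Continuous.mul (by fun_prop) (hV.comp continuous_fst))

theorem integral_sq_eq (hg : Continuous g)
    (h : ∀ x, g x = lam * sineKernel x s + lam * ∫ y in (0 : ℝ)..s, sineKernel x y * g y) :
    Integrable (fun x => g x ^ 2) ∧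
      ∫ x, g x ^ 2 = lam * ((∫ y in (0 : ℝ)..s, g y ^ 2) + g s) := by
  have h0 := integral_mul_bandlimited hg h (continuous_spectralDensity (lam := lam) (s := s) hg)
  simp only [← eq_bandlimited hg h, ← sq, ← Complex.ofReal_pow] at h0
  refine ⟨h0.1.re, ?_⟩
  have h1 := h0.2
  rw [integral_complex_ofReal, intervalIntegral.integral_ofReal] at h1
  exact_mod_cast h1

/-- A band-limited function vanishing at `0` is divisible by `x`. -/
theorem exists_bandlimited_div {U : ℝ → ℂ} (hU : Continuous U) (h0 : bandlimited U 0 = 0) :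
    ∃ V : ℝ → ℂ, Continuous V ∧ ∀ x : ℝ, x * bandlimited V x = bandlimited U x := by
  -- Dividing by `x` amounts to integrating the density. The boundary term at `1 / 2` is the value
  -- of the function at `0`, which vanishes.
  let F : ℝ → ℂ := fun k => ∫ κ in (-(1 / 2) : ℝ)..k, U κ
  have hF : ∀ k, HasDerivAt F (U k) k := fun k => (hU.integral_hasStrictDerivAt _ k).hasDerivAt
  have hFc : Continuous F := continuous_iff_continuousAt.2 fun k => (hF k).continuousAt
  refine ⟨fun k => 2 * Real.pi * Complex.I * F k, by fun_prop, fun x => ?_⟩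
  have hF1 : F (1 / 2) = 0 := by
    rw [← h0, bandlimited]
    simp [F]
  have hF0 : F (-(1 / 2)) = 0 := by simp [F]
  have he : ∀ k : ℝ, HasDerivAt (fun k : ℝ => Complex.exp (-(2 * Real.pi * k * x * Complex.I)))
      (-(2 * Real.pi * x * Complex.I) * Complex.exp (-(2 * Real.pi * k * x * Complex.I))) k := by
    intro k
    have h1 : HasDerivAt (fun k : ℝ => -(2 * Real.pi * (k : ℂ) * x * Complex.I))
        (-(2 * Real.pi * x * Complex.I)) k := by
      have h2 := ((Complex.ofRealCLM.hasDerivAt (x := k)).const_mul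
        (-(2 * Real.pi * x * Complex.I) : ℂ))
      refine (HasDerivAt.congr_deriv h2 (by simp)).congr_of_eventuallyEq
        (Filter.Eventually.of_forall fun k => ?_)
      simp only [Complex.ofRealCLM_apply]
      ring
    refine HasDerivAt.congr_deriv h1.cexp ?_
    ring
  have hparts := intervalIntegral.integral_mul_deriv_eq_deriv_mul
    (a := (-(1 / 2) : ℝ)) (b := 1 / 2)
    (fun k _ => he k) (fun k _ => hF k)
    (Continuous.intervalIntegrable (by fun_prop) _ _) (hU.intervalIntegrable _ _)
  rw [hF1, hF0, mul_zero, mul_zero, sub_zero, zero_sub] at hparts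
  rw [bandlimited, bandlimited, hparts, ← intervalIntegral.integral_neg,
    ← intervalIntegral.integral_const_mul]
  refine intervalIntegral.integral_congr fun k _ => ?_
  ring

/-- As `g 0 = 0`, both `g(x) / x` and `f(x) = g(x) (x - s) / x` are band-limited, and `f s = 0`.
Pairing `f` with `g` gives `∫ g² (x - s) / x = lam ∫₀ˢ g² (x - s) / x`, first over the line and then
over `(0, s)`. The weight is nonpositive inside and nonnegative outside, so for `lam ≥ 1` the outer
integral vanishes. Then `g = 0` beyond `s`, and at `s` by continuity. -/
theorem apply_eq_zero_of_apply_zero (hlam : 1 ≤ lam) (hs : 0 < s) (hg : Continuous g)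
    (h : ∀ x, g x = lam * sineKernel x s + lam * ∫ y in (0 : ℝ)..s, sineKernel x y * g y)
    (h0 : g 0 = 0) : g s = 0 := by
  have hUc := continuous_spectralDensity (lam := lam) (s := s) hg
  have hgU := eq_bandlimited hg h
  obtain ⟨V, hV, hdiv⟩ := exists_bandlimited_div hUc (by rw [← hgU 0, h0, Complex.ofReal_zero])
  have hW : Continuous fun k => spectralDensity lam s g k - s * V k :=
    hUc.sub (continuous_const.mul hV)
  have hWb : ∀ x, bandlimited (fun k => spectralDensity lam s g k - s * V k) x =
      g x - s * bandlimited V x := by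
    intro x
    rw [hgU, bandlimited, bandlimited, bandlimited, ← intervalIntegral.integral_const_mul,
      ← intervalIntegral.integral_sub]
    · refine intervalIntegral.integral_congr fun k _ => ?_
      ring
    · exact Continuous.intervalIntegrable (Continuous.mul (by fun_prop) hUc) _ _
    · exact Continuous.intervalIntegrable
        (continuous_const.mul (Continuous.mul (by fun_prop) hV)) _ _
  obtain ⟨hint, heq⟩ := integral_mul_bandlimited hg h hW
  simp only [hWb] at hint heq
  rw [hdiv, hgU, sub_self, add_zero] at heq
  let φ : ℝ → ℝ := fun x => g x ^ 2 * ((x - s) / x)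
  have hφ : ∀ x : ℝ, x ≠ 0 → (g x : ℂ) * (g x - s * bandlimited V x) = (φ x : ℂ) := by
    intro x hx
    have hx' : (x : ℂ) ≠ 0 := by exact_mod_cast hx
    have h1 : bandlimited V x = g x / x := by
      rw [eq_div_iff hx', mul_comm, hdiv, hgU]
    rw [h1]
    simp only [φ]
    push_cast
    field_simp
  have hae : ∀ᵐ x : ℝ, x ≠ 0 := compl_mem_ae_iff.2 (measure_singleton (0 : ℝ))
  have haeφ : (fun x : ℝ => (g x : ℂ) * (g x - s * bandlimited V x)) =ᵐ[volume]
      fun x => (φ x : ℂ) := by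
    filter_upwards [hae] with x hx using hφ x hx
  have hint' : Integrable φ := (hint.congr haeφ).re
  have heq' : ∫ x, φ x = lam * ∫ x in Set.Ioc 0 s, φ x := by
    rw [integral_congr_ae haeφ, intervalIntegral.integral_of_le hs.le,
      integral_congr_ae (ae_restrict_of_ae haeφ), integral_complex_ofReal,
      integral_complex_ofReal] at heq
    exact_mod_cast heq
  rw [← integral_add_compl measurableSet_Ioc hint'] at heq'
  have hin : ∫ x in Set.Ioc 0 s, φ x ≤ 0 := by
    refine setIntegral_nonpos measurableSet_Ioc fun x hx => ?_
    exact mul_nonpos_of_nonneg_of_nonpos (sq_nonneg _)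
      (div_nonpos_of_nonpos_of_nonneg (by linarith [hx.2]) hx.1.le)
  have hnn : ∀ x ∈ (Set.Ioc 0 s)ᶜ, 0 ≤ φ x := by
    intro x hx
    refine mul_nonneg (sq_nonneg _) ?_
    rcases le_or_gt x 0 with hx0 | hx0
    · exact div_nonneg_of_nonpos (by linarith) hx0
    · have : s < x := by
        by_contra hcon
        exact hx ⟨hx0, not_lt.1 hcon⟩
      exact div_nonneg (by linarith) hx0.le
  -- The outer integral equals `lam - 1` times the inner one, which is nonpositive.
  have hzero : ∫ x in (Set.Ioc 0 s)ᶜ, φ x = 0 := by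
    refine le_antisymm ?_ (setIntegral_nonneg measurableSet_Ioc.compl hnn)
    nlinarith
  rw [setIntegral_eq_zero_iff_of_nonneg_ae
    (by filter_upwards [ae_restrict_mem measurableSet_Ioc.compl] with x hx using hnn x hx)
    hint'.integrableOn] at hzero
  have hsub : Set.Ioi s ⊆ (Set.Ioc 0 s)ᶜ := fun x hx hx' => absurd hx'.2 (not_le.2 hx)
  have hg0 : g =ᵐ[volume.restrict (Set.Ioi s)] fun _ => 0 := by
    filter_upwards [ae_restrict_of_ae_restrict_of_subset hsub hzero,
      ae_restrict_mem measurableSet_Ioi] with x hx hxs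
    have h1 : (x - s) / x ≠ 0 :=
      div_ne_zero (sub_ne_zero.2 (ne_of_gt hxs)) (hs.trans hxs).ne'
    simpa [φ, h1] using hx
  have hEq := Measure.eqOn_open_of_ae_eq hg0 isOpen_Ioi hg.continuousOn continuousOn_const
  have hcl := hEq.closure hg continuous_const
  rw [closure_Ioi] at hcl
  exact hcl Set.self_mem_Ici

end

/-! ### Positivity of `D` and nonvanishing of the off-diagonal edge value. -/

open Filter Topology

theorem entire_eq_of_eqOn_Ioo {E F : ℂ → ℂ} (hE : Differentiable ℂ E) (hF : Differentiable ℂ F)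
    {c d : ℝ} (hcd : c < d) (h : ∀ x ∈ Set.Ioo c d, E x = F x) : E = F := by
  obtain ⟨m, hm⟩ := Set.nonempty_Ioo.2 hcd
  have hEa : AnalyticOnNhd ℂ E Set.univ := fun z _ => hE.analyticAt z
  have hFa : AnalyticOnNhd ℂ F Set.univ := fun z _ => hF.analyticAt z
  refine hEa.eq_of_frequently_eq hFa (z₀ := (m : ℂ)) ?_
  have ht : Tendsto (fun x : ℝ => (x : ℂ)) (𝓝[≠] m) (𝓝[≠] (m : ℂ)) := by
    refine tendsto_nhdsWithin_iff.2 ⟨?_, ?_⟩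
    · exact Complex.continuous_ofReal.continuousAt.tendsto.mono_left nhdsWithin_le_nhds
    · filter_upwards [self_mem_nhdsWithin] with x hx
      simpa using hx
  refine ht.frequently (Eventually.frequently ?_)
  filter_upwards [nhdsWithin_le_nhds (Ioo_mem_nhds hm.1 hm.2)] with x hx using h x hx

/-- A continuous function on `[0, s]` without zeros is positive if it is positive at `0`. -/
theorem pos_of_continuousOn_of_ne_zero {f : ℝ → ℝ} {s : ℝ} (hf : ContinuousOn f (Set.Icc 0 s))
    (h0 : 0 < f 0) (hne : ∀ x ∈ Set.Icc 0 s, f x ≠ 0) : ∀ x ∈ Set.Icc 0 s, 0 < f x := by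
  intro x hx
  by_contra hneg
  obtain ⟨c, hc, hc0⟩ := intermediate_value_Icc' hx.1
    (hf.mono (Set.Icc_subset_Icc_right hx.2)) ⟨not_lt.1 hneg, h0.le⟩
  exact hne c ⟨hc.1, hc.2.trans hx.2⟩ hc0

section

variable {lam s : ℝ}

theorem resolvent_endpoint_eq (hs : 0 < s) (hD : D s lam ≠ 0) (x : ℝ) :
    resolvent sineKernel lam s x s = lam * sineKernel x s +
      lam * ∫ y in (0 : ℝ)..s, sineKernel x y * resolvent sineKernel lam s y s := by
  rw [D_eq_fredholmDet] at hD
  exact bddContKernel_sineKernel.resolvent_eq hs hD x s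

/-- For `g = R(·, s)`, Plancherel gives `∫ g² = lam (∫₀ˢ g² + g s)` with the left side over the
whole line; the mass outside `(0, s)` is dropped. -/
theorem one_sub_mul_integral_sq_le (hs : 0 < s) (hD : D s lam ≠ 0) :
    (1 - lam) * ∫ y in (0 : ℝ)..s, resolvent sineKernel lam s y s ^ 2 ≤ lam * edgeDiag lam s := by
  have hg := bddContKernel_sineKernel.continuous_resolvent_left (lam := lam) (s := s) s
  obtain ⟨hi, h⟩ := integral_sq_eq hg (resolvent_endpoint_eq hs hD)
  rw [resolvent_self_eq_edgeDiag hs hD] at h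
  have h1 : ∫ y in (0 : ℝ)..s, resolvent sineKernel lam s y s ^ 2 ≤
      ∫ y, resolvent sineKernel lam s y s ^ 2 := by
    rw [intervalIntegral.integral_of_le hs.le]
    exact setIntegral_le_integral hi (Eventually.of_forall fun y => sq_nonneg _)
  linarith

/-- This bounds `-(log D)'` above uniformly on bounded intervals, so that `D` cannot descend to
zero. -/
theorem edgeDiag_le (hlam : lam < 1) (hs : 0 < s) (hD : D s lam ≠ 0) :
    edgeDiag lam s ≤ |lam| * (2 + s / (1 - lam)) := by
  have hR : 0 ≤ |lam| * (2 + s / (1 - lam)) := by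
    have : 0 < 1 - lam := by linarith
    positivity
  have hbound := one_sub_mul_integral_sq_le hs hD
  have hg := bddContKernel_sineKernel.continuous_resolvent_left (lam := lam) (s := s) s
  set g : ℝ → ℝ := fun y => resolvent sineKernel lam s y s with hgdef
  set X := ∫ y in (0 : ℝ)..s, g y ^ 2 with hX
  have hX0 : 0 ≤ X := intervalIntegral.integral_nonneg hs.le fun y _ => sq_nonneg _
  rcases lt_trichotomy lam 0 with h | h | h
  · refine le_trans ?_ hR
    by_contra hcon
    nlinarith [mul_nonneg (show 0 ≤ 1 - lam by linarith) hX0, not_le.1 hcon]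
  · refine le_trans (le_of_eq ?_) hR
    rw [edgeDiag, resolvent, h]
    simp
  · have ha : 0 ≤ edgeDiag lam s := by
      by_contra hcon
      nlinarith [mul_nonneg (show 0 ≤ 1 - lam by linarith) hX0, not_le.1 hcon]
    have heq := resolvent_endpoint_eq hs hD s
    rw [resolvent_self_eq_edgeDiag hs hD, sineKernel_self, mul_one] at heq
    -- In `K g ≤ c g² + 1 / (4c)` this choice makes the first term contribute at most half of
    -- `edgeDiag`, which is absorbed on the left.
    set c : ℝ := (1 - lam) / 2 with hc
    have hcpos : 0 < c := by rw [hc]; linarith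
    have hint : ∫ y in (0 : ℝ)..s, sineKernel s y * g y ≤
        ∫ y in (0 : ℝ)..s, (c * g y ^ 2 + 1 / (4 * c)) := by
      refine intervalIntegral.integral_mono_on hs.le ?_ ?_ fun y _ => ?_
      · exact ((bddContKernel_sineKernel.continuous_right s).mul hg).intervalIntegrable _ _
      · exact ((continuous_const.mul (hg.pow 2)).add continuous_const).intervalIntegrable _ _
      · have hK : sineKernel s y ^ 2 ≤ 1 := (sq_le_one_iff_abs_le_one _).2 (abs_sineKernel_le _ _)
        have h1 : c * g y ^ 2 + sineKernel s y ^ 2 / (4 * c) - sineKernel s y * g y =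
            (2 * c * g y - sineKernel s y) ^ 2 / (4 * c) := by
          field_simp
          ring
        have h2 : 0 ≤ (2 * c * g y - sineKernel s y) ^ 2 / (4 * c) := by positivity
        have h3 : sineKernel s y ^ 2 / (4 * c) ≤ 1 / (4 * c) := by gcongr
        linarith
    have hgi : IntervalIntegrable (fun y => c * g y ^ 2) volume 0 s :=
      (continuous_const.mul (hg.pow 2)).intervalIntegrable _ _
    rw [intervalIntegral.integral_add hgi intervalIntegrable_const,
      intervalIntegral.integral_const_mul, intervalIntegral.integral_const, ← hX, sub_zero,
      smul_eq_mul] at hint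
    have h4 : s * (1 / (4 * c)) = s / (1 - lam) / 2 := by
      rw [hc]
      have : (1 - lam) ≠ 0 := by linarith
      field_simp
      norm_num
    rw [h4] at hint
    have h5 : lam * ∫ y in (0 : ℝ)..s, sineKernel s y * g y ≤
        lam * (c * X + s / (1 - lam) / 2) := mul_le_mul_of_nonneg_left hint h.le
    have h6 : lam * (c * X) ≤ edgeDiag lam s / 2 := by
      have : c * X ≤ lam * edgeDiag lam s / 2 := by rw [hc]; linarith
      nlinarith [mul_le_mul_of_nonneg_left this h.le,
        mul_nonneg ha (show (0 : ℝ) ≤ 1 - lam ^ 2 by nlinarith)]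
    rw [abs_of_pos h]
    linarith

/-- A Grönwall argument: up to the first `t` with `D t ≤ 0`, the function `D x * exp (C x)` is
nondecreasing and starts at `1`. -/
theorem D_pos_of_lt_one (hlam : lam < 1) (hs : 0 ≤ s) : 0 < D s lam := by
  by_contra hneg
  set Z : Set ℝ := Set.Icc 0 s ∩ (fun x => D x lam) ⁻¹' Set.Iic 0 with hZ
  have hcont : ContinuousOn (fun x => D x lam) (Set.Icc 0 s) :=
    (continuousOn_D lam).mono Set.Icc_subset_Ici_self
  have hZc : IsClosed Z := hcont.preimage_isClosed_of_isClosed isClosed_Icc isClosed_Iic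
  have hZk : IsCompact Z := isCompact_Icc.of_isClosed_subset hZc Set.inter_subset_left
  obtain ⟨t, ht, hmin⟩ := hZk.exists_isLeast ⟨s, ⟨hs, le_rfl⟩, not_lt.1 hneg⟩
  have ht0 : 0 < t := by
    refine lt_of_le_of_ne ht.1.1 fun h => ?_
    have := ht.2
    rw [← h, Set.mem_preimage, D_zero] at this
    exact absurd this (by norm_num)
  have hpos : ∀ x, 0 ≤ x → x < t → 0 < D x lam := by
    intro x hx hxt
    by_contra hcon
    exact absurd (hmin ⟨⟨hx, hxt.le.trans ht.1.2⟩, not_lt.1 hcon⟩) (not_le.2 hxt)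
  set C := |lam| * (2 + s / (1 - lam)) with hC
  have hmono : MonotoneOn (fun x => D x lam * Real.exp (C * x)) (Set.Icc 0 t) := by
    have hd : ∀ x ∈ interior (Set.Icc 0 t), HasDerivAt (fun x => D x lam * Real.exp (C * x))
        ((C - edgeDiag lam x) * (D x lam * Real.exp (C * x))) x := by
      intro x hx
      rw [interior_Icc] at hx
      have h1 := hasDerivAt_D hx.1 (hpos x hx.1.le hx.2).ne'
      refine HasDerivAt.congr_deriv (h1.mul ((hasDerivAt_id x).const_mul C).exp) ?_
      simp only [id]
      ring
    refine monotoneOn_of_deriv_nonneg (convex_Icc 0 t) ?_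
      (fun x hx => (hd x hx).differentiableAt.differentiableWithinAt) fun x hx => ?_
    · exact (hcont.mono (Set.Icc_subset_Icc_right ht.1.2)).mul
        (Continuous.continuousOn (by fun_prop))
    · rw [(hd x hx).deriv]
      rw [interior_Icc] at hx
      have hDx := hpos x hx.1.le hx.2
      refine mul_nonneg (sub_nonneg.2 ((edgeDiag_le hlam hx.1 hDx.ne').trans ?_))
        (mul_nonneg hDx.le (Real.exp_nonneg _))
      rw [hC]
      have h1 : 0 < 1 - lam := by linarith
      have h2 : x ≤ s := hx.2.le.trans ht.1.2
      gcongr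
  have h := hmono (Set.left_mem_Icc.2 ht0.le) (Set.right_mem_Icc.2 ht0.le) ht0.le
  simp only [D_zero, mul_zero, Real.exp_zero, mul_one] at h
  have : D t lam * Real.exp (C * t) ≤ 0 := mul_nonpos_of_nonpos_of_nonneg ht.2 (Real.exp_nonneg _)
  linarith

/-- The derivative of `edgeDiag` is a square and its initial value is `lam`. -/
theorem le_edgeDiag (hs : 0 ≤ s) (hD : ∀ x ∈ Set.Icc 0 s, D x lam ≠ 0) : lam ≤ edgeDiag lam s := by
  have hmono : MonotoneOn (edgeDiag lam) (Set.Icc 0 s) := by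
    have hd : ∀ x ∈ interior (Set.Icc 0 s),
        HasDerivAt (edgeDiag lam) (edgeCross lam x ^ 2) x := by
      intro x hx
      have hx' := interior_subset hx
      rw [interior_Icc] at hx
      exact hasDerivAt_edgeDiag hx.1 (hD x hx')
    refine monotoneOn_of_deriv_nonneg (convex_Icc 0 s)
      (continuousOn_edgeDiag Set.Icc_subset_Ici_self hD)
      (fun x hx => (hd x hx).differentiableAt.differentiableWithinAt) fun x hx => ?_
    rw [(hd x hx).deriv]
    exact sq_nonneg _
  have := hmono (Set.left_mem_Icc.2 hs) (Set.right_mem_Icc.2 hs) hs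
  rwa [edgeDiag_zero] at this

theorem antitoneOn_D (h0 : 0 ≤ lam) (h1 : lam < 1) :
    AntitoneOn (fun x => D x lam) (Set.Ici 0) := by
  have hd : ∀ x ∈ interior (Set.Ici (0 : ℝ)), HasDerivAt (fun x => D x lam)
      (-edgeDiag lam x * D x lam) x := by
    intro x hx
    rw [interior_Ici] at hx
    exact hasDerivAt_D hx (D_pos_of_lt_one h1 (le_of_lt hx)).ne'
  refine antitoneOn_of_deriv_nonpos (convex_Ici 0) (continuousOn_D lam)
    (fun x hx => (hd x hx).differentiableAt.differentiableWithinAt) fun x hx => ?_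
  rw [(hd x hx).deriv]
  have hx' : 0 ≤ x := interior_subset hx
  have ha : lam ≤ edgeDiag lam x :=
    le_edgeDiag hx' fun y hy => (D_pos_of_lt_one h1 hy.1).ne'
  rw [neg_mul]
  exact neg_nonpos.2 (mul_nonneg (h0.trans ha) (D_pos_of_lt_one h1 hx').le)

theorem tendsto_D_one (s : ℝ) : Tendsto (fun lam => D s lam) (𝓝[<] 1) (𝓝 (D s 1)) := by
  have hc : ContinuousOn (fun lam => D s lam) (Set.Icc 0 1) := by
    simp only [D_eq_fredholmDet, fredholmDet_eq_tsum]
    refine continuousOn_tsum (fun n => Continuous.continuousOn (by fun_prop))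
      (bddContKernel_sineKernel.summable_det_term s (-1)).abs fun n lam hlam => ?_
    rw [norm_mul, norm_div, norm_pow, norm_neg, Real.norm_natCast, neg_neg, one_pow, abs_mul,
      Real.norm_eq_abs, Real.norm_eq_abs, abs_div, abs_one, Nat.abs_cast, abs_of_nonneg hlam.1]
    gcongr
    exact pow_le_one₀ hlam.1 hlam.2
  have h := (hc 1 (by simp)).tendsto
  refine h.mono_left ?_
  rw [← nhdsWithin_Ioo_eq_nhdsLT zero_lt_one]
  exact nhdsWithin_mono _ Set.Ioo_subset_Icc_self

/-- As a limit of positive decreasing functions, `D x 1` would vanish for all `x ≥ s` once it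
vanishes at `s`. Its entire continuation would then be zero, against the value `1` at `0`. -/
theorem D_one_pos (hs : 0 ≤ s) : 0 < D s 1 := by
  have hnn : ∀ x, 0 ≤ x → 0 ≤ D x 1 := fun x hx =>
    ge_of_tendsto (tendsto_D_one x) (by
      filter_upwards [self_mem_nhdsWithin] with lam hlam using (D_pos_of_lt_one hlam hx).le)
  refine lt_of_le_of_ne (hnn s hs) fun h0 => ?_
  have hzero : ∀ x, s ≤ x → D x 1 = 0 := by
    intro x hx
    refine le_antisymm ?_ (hnn x (hs.trans hx))
    rw [h0]
    refine le_of_tendsto_of_tendsto (tendsto_D_one x) (tendsto_D_one s) ?_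
    filter_upwards [Ioo_mem_nhdsLT (show (0 : ℝ) < 1 by norm_num)] with lam hlam
    exact antitoneOn_D hlam.1.le hlam.2 hs (hs.trans hx) hx
  obtain ⟨E, hE, hED⟩ := exists_entire_D 1
  have := entire_eq_of_eqOn_Ioo hE (differentiable_const 0) (lt_add_one s) fun x hx => by
    rw [hED x (hs.trans hx.1.le), hzero x hx.1.le, Complex.ofReal_zero]
  have h1 := hED 0 le_rfl
  rw [this, D_zero] at h1
  simp at h1

theorem D_pos (hD : lam ≤ 1 ∨ ∀ x ∈ Set.Ioc 0 s, D x lam ≠ 0) :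
    ∀ x ∈ Set.Icc 0 s, 0 < D x lam := by
  intro x hx
  rcases hD with h | h
  · rcases h.lt_or_eq with h | rfl
    · exact D_pos_of_lt_one h hx.1
    · exact D_one_pos hx.1
  · refine pos_of_continuousOn_of_ne_zero
      ((continuousOn_D lam).mono Set.Icc_subset_Ici_self) (by rw [D_zero]; exact one_pos)
      (fun y hy => ?_) x hx
    rcases hy.1.eq_or_lt with rfl | hy0
    · rw [D_zero]
      exact one_ne_zero
    · exact h y ⟨hy0, hy.2⟩

/-- The off-diagonal edge value of the resolvent does not vanish for `lam ≥ 1`. -/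
theorem edgeCross_ne_zero (hlam : 1 ≤ lam) (hs : 0 < s) (hD : ∀ x ∈ Set.Icc 0 s, D x lam ≠ 0) :
    edgeCross lam s ≠ 0 := by
  intro h0
  have hDs := hD s (Set.right_mem_Icc.2 hs.le)
  have h := apply_eq_zero_of_apply_zero hlam hs
    (bddContKernel_sineKernel.continuous_resolvent_left s) (resolvent_endpoint_eq hs hDs) h0
  rw [resolvent_self_eq_edgeDiag hs hDs] at h
  linarith [le_edgeDiag hs.le hD]

end

/-! ### Parity determinants: factorization and logarithmic derivatives. -/

/-- The determinants of the even (`ε = 1`) and odd (`ε = -1`) parts. -/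
noncomputable def parityDet (ε s lam : ℝ) : ℝ := fredholmDet (parityKernel ε) 0 (s / 2) lam

section

variable {lam s ε : ℝ}

theorem parityDet_zero (hε : |ε| = 1) : parityDet ε 0 lam = 1 := by
  rw [parityDet, zero_div, (bddContKernel_parityKernel hε).fredholmDet_zero]

theorem continuousOn_parityDet (hε : |ε| = 1) :
    ContinuousOn (fun s => parityDet ε s lam) (Set.Ici 0) := by
  refine ((bddContKernel_parityKernel hε).continuousOn_fredholmDet lam).comp
    (f := fun s => s / 2) (Continuous.continuousOn (by fun_prop)) fun x hx => ?_
  exact div_nonneg (Set.mem_Ici.1 hx) zero_le_two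

theorem hasDerivAt_log_parityDet (hε : |ε| = 1) (hs : 0 < s) (hD : D s lam ≠ 0)
    (hDε : parityDet ε s lam ≠ 0) : HasDerivAt (fun x => Real.log (parityDet ε x lam))
      (-(edgeDiag lam s + ε * edgeCross lam s) / 2) s := by
  refine HasDerivAt.congr_deriv ((hasDerivAt_parity hε hs hD hDε).log hDε) ?_
  exact mul_div_cancel_right₀ _ hDε

theorem hasDerivAt_log_D (hs : 0 < s) (hD : D s lam ≠ 0) :
    HasDerivAt (fun x => Real.log (D x lam)) (-edgeDiag lam s) s :=
  HasDerivAt.congr_deriv ((hasDerivAt_D hs hD).log hD) (mul_div_cancel_right₀ _ hD)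

theorem pos_near_zero {f : ℝ → ℝ} (hf : ContinuousOn f (Set.Ici 0)) (h0 : f 0 = 1) :
    ∃ δ > 0, ∀ x ∈ Set.Icc 0 δ, 0 < f x := by
  have h : ∀ᶠ x in 𝓝[≥] (0 : ℝ), 0 < f x :=
    (hf 0 Set.self_mem_Ici).eventually_const_lt (by rw [h0]; exact one_pos)
  obtain ⟨δ, hδ, h⟩ := mem_nhdsGE_iff_exists_Icc_subset.1 h
  exact ⟨δ, hδ, h⟩

theorem eq_of_hasDerivAt_zero {f : ℝ → ℝ} {b : ℝ} (hb : 0 ≤ b) (hf : ContinuousOn f (Set.Icc 0 b))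
    (hd : ∀ x ∈ Set.Ioo 0 b, HasDerivAt f 0 x) : f b = f 0 := by
  have h := intervalIntegral.integral_eq_sub_of_hasDerivAt_of_le hb hf hd
    intervalIntegrable_const
  simp only [intervalIntegral.integral_zero] at h
  linarith

/-- The determinant factors over the even and odd parts. -/
theorem parityDet_mul (hs : 0 ≤ s) : parityDet 1 s lam * parityDet (-1) s lam = D s lam := by
  have hp : |(1 : ℝ)| = 1 := abs_one
  have hm : |(-1 : ℝ)| = 1 := by simp
  obtain ⟨δ, hδ, h0⟩ := pos_near_zero (continuousOn_D lam) (D_zero lam)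
  obtain ⟨δp, hδp, hplus⟩ := pos_near_zero (continuousOn_parityDet (lam := lam) hp)
    (parityDet_zero hp)
  obtain ⟨δm, hδm, hminus⟩ := pos_near_zero (continuousOn_parityDet (lam := lam) hm)
    (parityDet_zero hm)
  -- Logarithms are available only while no determinant vanishes, so the identity is proved on `[0,
  -- η]`; the entire continuations carry it to every `s ≥ 0`.
  set η := min δ (min δp δm) with hη
  have hηpos : 0 < η := lt_min hδ (lt_min hδp hδm)
  have hD : ∀ x ∈ Set.Icc 0 η, 0 < D x lam := fun x hx => h0 x ⟨hx.1, hx.2.trans (min_le_left _ _)⟩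
  have hP : ∀ x ∈ Set.Icc 0 η, 0 < parityDet 1 x lam := fun x hx =>
    hplus x ⟨hx.1, hx.2.trans ((min_le_right _ _).trans (min_le_left _ _))⟩
  have hM : ∀ x ∈ Set.Icc 0 η, 0 < parityDet (-1) x lam := fun x hx =>
    hminus x ⟨hx.1, hx.2.trans ((min_le_right _ _).trans (min_le_right _ _))⟩
  have hsmall : ∀ x ∈ Set.Icc 0 η, parityDet 1 x lam * parityDet (-1) x lam = D x lam := by
    intro b hb
    have hsub : Set.Icc 0 b ⊆ Set.Icc 0 η := Set.Icc_subset_Icc_right hb.2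
    have h1 := eq_of_hasDerivAt_zero (f := fun x => Real.log (parityDet 1 x lam) +
      Real.log (parityDet (-1) x lam) - Real.log (D x lam)) hb.1 (by
        refine ContinuousOn.sub (ContinuousOn.add ?_ ?_) ?_
        · exact ((continuousOn_parityDet hp).mono Set.Icc_subset_Ici_self).log
            fun x hx => (hP x (hsub hx)).ne'
        · exact ((continuousOn_parityDet hm).mono Set.Icc_subset_Ici_self).log
            fun x hx => (hM x (hsub hx)).ne'
        · exact ((continuousOn_D lam).mono Set.Icc_subset_Ici_self).log
            fun x hx => (hD x (hsub hx)).ne') (fun x hx => by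
        have hx' := hsub (Set.Ioo_subset_Icc_self hx)
        refine HasDerivAt.congr_deriv
          (((hasDerivAt_log_parityDet hp hx.1 (hD x hx').ne' (hP x hx').ne').add
          (hasDerivAt_log_parityDet hm hx.1 (hD x hx').ne' (hM x hx').ne')).sub
          (hasDerivAt_log_D hx.1 (hD x hx').ne')) ?_
        ring)
    simp only [parityDet_zero hp, parityDet_zero hm, D_zero, Real.log_one, add_zero,
      sub_zero] at h1
    rw [← Real.log_mul (hP b hb).ne' (hM b hb).ne', sub_eq_zero] at h1
    exact Real.log_injOn_pos (mul_pos (hP b hb) (hM b hb)) (hD b hb) h1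
  obtain ⟨E, hE, hED⟩ := exists_entire_D lam
  obtain ⟨P, hPd, hPD⟩ := exists_entire_parity hp lam
  obtain ⟨Q, hQd, hQD⟩ := exists_entire_parity hm lam
  have h := entire_eq_of_eqOn_Ioo (hPd.mul hQd) hE hηpos fun x hx => by
    rw [Pi.mul_apply, hPD x hx.1.le, hQD x hx.1.le, hED x hx.1.le,
      ← hsmall x (Set.Ioo_subset_Icc_self hx)]
    push_cast
    rfl
  have h2 := congrFun h (s : ℂ)
  rw [Pi.mul_apply, hPD s hs, hQD s hs, hED s hs] at h2
  exact_mod_cast h2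

/-- By the factorization a zero of either factor is a zero of `D`; the sign is fixed by the value
`1` at `0`. -/
theorem parityDet_pos (hε : ε = 1 ∨ ε = -1) (hs : 0 ≤ s)
    (hD : ∀ x ∈ Set.Icc 0 s, 0 < D x lam) : 0 < parityDet ε s lam := by
  have hε' : |ε| = 1 := by rcases hε with rfl | rfl <;> simp
  refine pos_of_continuousOn_of_ne_zero
    ((continuousOn_parityDet hε').mono Set.Icc_subset_Ici_self)
    (by rw [parityDet_zero hε']; exact one_pos) (fun x hx h0 => ?_) s (Set.right_mem_Icc.2 hs)
  have h1 := (hD x hx).ne'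
  rw [← parityDet_mul hx.1] at h1
  rcases hε with rfl | rfl
  · exact h1 (by rw [h0, zero_mul])
  · exact h1 (by rw [h0, mul_zero])

theorem Dplus_eq_parityDet (s lam : ℝ) : Dplus s lam = parityDet 1 s lam :=
  Dplus_eq_fredholmDet s lam

theorem Dminus_eq_parityDet (s lam : ℝ) : Dminus s lam = parityDet (-1) s lam :=
  Dminus_eq_fredholmDet s lam

/-- The logarithmic derivative of the determinants of the parity parts, in integrated form. -/
theorem log_parityDet_eq (hε : ε = 1 ∨ ε = -1) (hs : 0 ≤ s)
    (hD : ∀ x ∈ Set.Icc 0 s, 0 < D x lam) :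
    Real.log (parityDet ε s lam) =
      1 / 2 * Real.log (D s lam) - ε * (1 / 2 * ∫ x in (0 : ℝ)..s, edgeCross lam x) := by
  have hε' : |ε| = 1 := by rcases hε with rfl | rfl <;> simp
  have hP : ∀ x ∈ Set.Icc 0 s, 0 < parityDet ε x lam := fun x hx =>
    parityDet_pos hε hx.1 fun y hy => hD y ⟨hy.1, hy.2.trans hx.2⟩
  have h := intervalIntegral.integral_eq_sub_of_hasDerivAt_of_le (f := fun x =>
      Real.log (parityDet ε x lam) - 1 / 2 * Real.log (D x lam))
    (f' := fun x => -(ε / 2) * edgeCross lam x) hs (by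
      refine ContinuousOn.sub ?_ (continuousOn_const.mul ?_)
      · exact ((continuousOn_parityDet hε').mono Set.Icc_subset_Ici_self).log
          fun x hx => (hP x hx).ne'
      · exact ((continuousOn_D lam).mono Set.Icc_subset_Ici_self).log
          fun x hx => (hD x hx).ne') (fun x hx => by
      have hx' := Set.Ioo_subset_Icc_self hx
      refine HasDerivAt.congr_deriv
        ((hasDerivAt_log_parityDet hε' hx.1 (hD x hx').ne' (hP x hx').ne').sub
        ((hasDerivAt_log_D hx.1 (hD x hx').ne').const_mul (1 / 2))) ?_
      ring) (by
      refine ContinuousOn.intervalIntegrable_of_Icc hs (continuousOn_const.mul ?_)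
      exact continuousOn_edgeCross Set.Icc_subset_Ici_self fun x hx => (hD x hx).ne')
  rw [intervalIntegral.integral_const_mul, parityDet_zero hε', D_zero, Real.log_one] at h
  linarith

/-- Gaudin's relation for the second logarithmic derivative of the determinant. -/
theorem negLogDeriv2_eq {x : ℝ} (hD : ∀ y ∈ Set.Icc 0 s, 0 < D y lam) (hx : x ∈ Set.Ioo 0 s) :
    negLogDeriv2 lam x = edgeCross lam x ^ 2 := by
  have h1 : deriv (fun y => Real.log (D y lam)) =ᶠ[𝓝 x] fun y => -edgeDiag lam y := by
    filter_upwards [Ioo_mem_nhds hx.1 hx.2] with y hy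
    exact (hasDerivAt_log_D hy.1 (hD y (Set.Ioo_subset_Icc_self hy)).ne').deriv
  rw [negLogDeriv2, iteratedDeriv_succ, iteratedDeriv_one, h1.deriv_eq, deriv.fun_neg,
    (hasDerivAt_edgeDiag hx.1 (hD x (Set.Ioo_subset_Icc_self hx)).ne').deriv, neg_neg]

/-! ### The analytic branch of the square root. -/

theorem analyticAt_re_ofReal {E : ℂ → ℂ} (hE : Differentiable ℂ E) (x : ℝ) :
    AnalyticAt ℝ (fun y : ℝ => (E y).re) x := by
  have h1 : AnalyticAt ℝ E (x : ℂ) := (hE.analyticAt _).restrictScalars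
  exact (Complex.reCLM.analyticAt _).comp (h1.comp (Complex.ofRealCLM.analyticAt x))

theorem analyticAt_log_D (hs : 0 < s) (hD : 0 < D s lam) :
    AnalyticAt ℝ (fun x => Real.log (D x lam)) s := by
  obtain ⟨E, hE, hED⟩ := exists_entire_D lam
  have h : (fun y : ℝ => (E y).re) =ᶠ[𝓝 s] fun y => D y lam := by
    filter_upwards [lt_mem_nhds hs] with y hy
    rw [hED y hy.le, Complex.ofReal_re]
  exact ((analyticAt_re_ofReal hE s).congr h).log hD

/-- The determinants are constant for negative length and so in general not analytic at `0`; `L` is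
the logarithm of the entire continuation instead. -/
theorem exists_analytic_log_parityDet (hε : ε = 1 ∨ ε = -1)
    (hD : ∀ x ∈ Set.Icc 0 s, 0 < D x lam) :
    ∃ L : ℝ → ℝ, AnalyticOnNhd ℝ L (Set.Icc 0 s) ∧
      ∀ x, 0 ≤ x → L x = Real.log (parityDet ε x lam) := by
  have hε' : |ε| = 1 := by rcases hε with rfl | rfl <;> simp
  obtain ⟨E, hE, hED⟩ := exists_entire_parity hε' lam
  have h : ∀ x : ℝ, 0 ≤ x → (E x).re = parityDet ε x lam := fun x hx => by
    rw [hED x hx, Complex.ofReal_re, parityDet]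
  refine ⟨fun x => Real.log (E x).re, fun x hx => (analyticAt_re_ofReal hE x).log ?_,
    fun x hx => congrArg Real.log (h x hx)⟩
  rw [h x hx.1]
  exact parityDet_pos hε hx.1 fun y hy => hD y ⟨hy.1, hy.2.trans hx.2⟩

/-- The edge value `R(0, s)` of the resolvent extends analytically to a neighbourhood
of `[0, s]`. -/
theorem exists_analytic_edgeCross (hs : 0 < s) (hD : ∀ x ∈ Set.Icc 0 s, 0 < D x lam) :
    ∃ w : ℝ → ℝ, AnalyticOnNhd ℝ w (Set.Icc 0 s) ∧ w 0 = lam ∧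
      ∀ x ∈ Set.Ioo 0 s, w x = edgeCross lam x := by
  obtain ⟨P, hP, hPD⟩ := exists_analytic_log_parityDet (ε := 1) (Or.inl rfl) hD
  obtain ⟨Q, hQ, hQD⟩ := exists_analytic_log_parityDet (ε := -1) (Or.inr rfl) hD
  -- The odd and even logarithmic derivatives are `-(a - c) / 2` and `-(a + c) / 2`; their
  -- difference is `c`.
  have hw : AnalyticOnNhd ℝ (fun x => deriv Q x - deriv P x) (Set.Icc 0 s) :=
    fun x hx => (hQ x hx).deriv.sub (hP x hx).deriv
  have hwb : ∀ x ∈ Set.Ioo 0 s, deriv Q x - deriv P x = edgeCross lam x := by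
    intro x hx
    have hDx := hD x (Set.Ioo_subset_Icc_self hx)
    have key : ∀ {ε : ℝ} {L : ℝ → ℝ}, ε = 1 ∨ ε = -1 →
        (∀ x, 0 ≤ x → L x = Real.log (parityDet ε x lam)) →
        deriv L x = -(edgeDiag lam x + ε * edgeCross lam x) / 2 := by
      intro ε L hε hL
      have hε' : |ε| = 1 := by rcases hε with rfl | rfl <;> simp
      have h1 : L =ᶠ[𝓝 x] fun y => Real.log (parityDet ε y lam) := by
        filter_upwards [lt_mem_nhds hx.1] with y hy using hL y hy.le
      rw [h1.deriv_eq]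
      exact (hasDerivAt_log_parityDet hε' hx.1 hDx.ne' (parityDet_pos hε hx.1.le
        fun y hy => hD y ⟨hy.1, hy.2.trans hx.2.le⟩).ne').deriv
    rw [key (Or.inr rfl) hQD, key (Or.inl rfl) hPD]
    ring
  refine ⟨_, hw, ?_, hwb⟩
  have h0 : (0 : ℝ) ∈ Set.Icc 0 s := Set.left_mem_Icc.2 hs.le
  -- The difference is known to equal `edgeCross` only inside `(0, s)`, so its value at `0` is found
  -- as a limit from the right.
  have h1 : Tendsto (fun x => deriv Q x - deriv P x) (𝓝[>] 0) (𝓝 (deriv Q 0 - deriv P 0)) :=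
    (hw 0 h0).continuousAt.tendsto.mono_left nhdsWithin_le_nhds
  have h2 : Tendsto (edgeCross lam) (𝓝[>] 0) (𝓝 (edgeCross lam 0)) := by
    have := (continuousOn_edgeCross Set.Icc_subset_Ici_self fun x hx => (hD x hx).ne') 0 h0
    rw [← nhdsWithin_Ioo_eq_nhdsGT hs]
    exact this.tendsto.mono_left (nhdsWithin_mono _ Set.Ioo_subset_Icc_self)
  rw [edgeCross_zero] at h2
  refine tendsto_nhds_unique (h1.congr' ?_) h2
  filter_upwards [Ioo_mem_nhdsGT hs] with x hx using hwb x hx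

/-- The analytic branch of the square root is the edge value of the resolvent. -/
theorem IsAnalyticSqrt.eq_edgeCross (hs : 0 < s) (hD : ∀ x ∈ Set.Icc 0 s, 0 < D x lam)
    {w : ℝ → ℝ} (hw : IsAnalyticSqrt (negLogDeriv2 lam) lam s w) :
    ∀ x ∈ Set.Ioo 0 s, w x = edgeCross lam x := by
  obtain ⟨v, hv, hv0, hvb⟩ := exists_analytic_edgeCross hs hD
  obtain ⟨hwa, hw0, hwsq⟩ := hw
  have hsq : ∀ x ∈ Set.Ioo 0 s, w x ^ 2 = edgeCross lam x ^ 2 := fun x hx => by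
    rw [hwsq x hx, negLogDeriv2_eq hD hx]
  -- For `lam = 0` the value at `0` selects no sign, but then both functions vanish on `(0, s)`.
  by_cases hlam : lam = 0
  · intro x hx
    have hb : edgeCross lam x = 0 := by
      rw [edgeCross, resolvent, hlam]
      simp
    have := hsq x hx
    rw [hb] at this ⊢
    simpa using this
  have h0 : (0 : ℝ) ∈ Set.Icc 0 s := Set.left_mem_Icc.2 hs.le
  -- Near `0` the sum is close to `2 lam ≠ 0`, which excludes `w = -v`; the identity theorem extends
  -- `w = v` to `[0, s]`.
  have hsum : ∀ᶠ x in 𝓝[>] (0 : ℝ), w x + v x ≠ 0 := by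
    have hc : ContinuousAt (fun x => w x + v x) 0 :=
      (hwa 0 h0).continuousAt.add (hv 0 h0).continuousAt
    refine (hc.eventually_ne ?_).filter_mono nhdsWithin_le_nhds
    rw [hw0, hv0, ← two_mul]
    exact mul_ne_zero two_ne_zero hlam
  have hev : ∀ᶠ x in 𝓝[>] (0 : ℝ), w x = v x := by
    filter_upwards [hsum, Ioo_mem_nhdsGT hs] with x hx hxs
    have h1 : (w x - v x) * (w x + v x) = 0 := by
      have := hsq x hxs
      rw [← hvb x hxs] at this
      linear_combination this
    rcases mul_eq_zero.1 h1 with h | h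
    · exact sub_eq_zero.1 h
    · exact absurd h hx
  have hfreq : ∃ᶠ x in 𝓝[≠] (0 : ℝ), w x = v x :=
    hev.frequently.filter_mono (nhdsWithin_mono _ fun x hx => ne_of_gt hx)
  have hEq := hwa.eqOn_of_preconnected_of_frequently_eq hv isPreconnected_Icc h0 hfreq
  intro x hx
  rw [hEq (Set.Ioo_subset_Icc_self hx), hvb x hx]

theorem integral_congr_Ioo {f g : ℝ → ℝ} (hs : 0 ≤ s) (h : ∀ x ∈ Set.Ioo 0 s, f x = g x) :
    ∫ x in (0 : ℝ)..s, f x = ∫ x in (0 : ℝ)..s, g x := by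
  rw [intervalIntegral.integral_of_le hs, intervalIntegral.integral_of_le hs,
    integral_Ioc_eq_integral_Ioo, integral_Ioc_eq_integral_Ioo]
  exact setIntegral_congr_fun measurableSet_Ioo h

theorem log_Dplus_Dminus_eq (hs : 0 ≤ s) (hD : ∀ x ∈ Set.Icc 0 s, 0 < D x lam) {w : ℝ → ℝ}
    (hw : ∀ x ∈ Set.Ioo 0 s, w x = edgeCross lam x) :
    Real.log (Dplus s lam) =
        1 / 2 * Real.log (D s lam) - 1 / 2 * ∫ x in (0 : ℝ)..s, w x ∧
      Real.log (Dminus s lam) =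
        1 / 2 * Real.log (D s lam) + 1 / 2 * ∫ x in (0 : ℝ)..s, w x := by
  rw [integral_congr_Ioo hs hw, Dplus_eq_parityDet, Dminus_eq_parityDet,
    log_parityDet_eq (Or.inl rfl) hs hD, log_parityDet_eq (Or.inr rfl) hs hD]
  constructor <;> ring

/-- The edge value starts at `lam > 0` and has no zero: for `lam ≥ 1` by the band-limited argument,
otherwise because its square is assumed nonzero. -/
theorem edgeCross_pos (hD : ∀ x ∈ Set.Icc 0 s, 0 < D x lam)
    (h : 1 ≤ lam ∨ (0 < lam ∧ ∀ x ∈ Set.Ioo 0 s, negLogDeriv2 lam x ≠ 0)) :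
    ∀ x ∈ Set.Ioo 0 s, 0 < edgeCross lam x := by
  have hlam : 0 < lam := by
    rcases h with h | h
    · linarith
    · exact h.1
  intro x hx
  have hsub : Set.Icc 0 x ⊆ Set.Icc 0 s := Set.Icc_subset_Icc_right hx.2.le
  refine pos_of_continuousOn_of_ne_zero (s := x)
    (continuousOn_edgeCross Set.Icc_subset_Ici_self fun y hy => (hD y (hsub hy)).ne')
    (by rwa [edgeCross_zero]) (fun y hy => ?_) x (Set.right_mem_Icc.2 hx.1.le)
  rcases hy.1.eq_or_lt with rfl | hy0
  · rw [edgeCross_zero]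
    exact hlam.ne'
  · rcases h with h | h
    · exact edgeCross_ne_zero h hy0 fun z hz => (hD z (hsub ⟨hz.1, hz.2.trans hy.2⟩)).ne'
    · have hy' : y ∈ Set.Ioo 0 s := ⟨hy0, hy.2.trans_lt hx.2⟩
      have h1 := h.2 y hy'
      rw [negLogDeriv2_eq hD hy'] at h1
      exact fun h0 => h1 (by rw [h0]; simp)

end

end GapProb

/-! ### The theorem. -/

theorem theorem10 (lam s : ℝ) (hs : 0 < s)
    (hD : lam ≤ 1 ∨ ∀ x ∈ Set.Ioc 0 s, GapProb.D x lam ≠ 0) :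
    -- the logarithms are logarithms of positive numbers, and `log D` is smooth
    (∀ x ∈ Set.Icc 0 s,
      0 < GapProb.D x lam ∧ 0 < GapProb.Dplus x lam ∧ 0 < GapProb.Dminus x lam) ∧
    AnalyticOnNhd ℝ (fun x => Real.log (GapProb.D x lam)) (Set.Ioc 0 s) ∧
    -- the branch of the square root fixed by its value `lam` at `0` exists
    (∃ w : ℝ → ℝ, GapProb.IsAnalyticSqrt (GapProb.negLogDeriv2 lam) lam s w) ∧
    -- the formula with this branch
    (∀ w : ℝ → ℝ, GapProb.IsAnalyticSqrt (GapProb.negLogDeriv2 lam) lam s w →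
      Real.log (GapProb.Dplus s lam) =
        1 / 2 * Real.log (GapProb.D s lam) - 1 / 2 * ∫ x in (0 : ℝ)..s, w x ∧
      Real.log (GapProb.Dminus s lam) =
        1 / 2 * Real.log (GapProb.D s lam) + 1 / 2 * ∫ x in (0 : ℝ)..s, w x) ∧
    -- the formula with the nonnegative square root
    ((1 ≤ lam ∨ (0 < lam ∧ ∀ x ∈ Set.Ioo 0 s, GapProb.negLogDeriv2 lam x ≠ 0)) →
      (∀ x ∈ Set.Ioo 0 s, 0 < GapProb.negLogDeriv2 lam x) ∧
      Real.log (GapProb.Dplus s lam) =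
        1 / 2 * Real.log (GapProb.D s lam)
          - 1 / 2 * ∫ x in (0 : ℝ)..s, Real.sqrt (GapProb.negLogDeriv2 lam x) ∧
      Real.log (GapProb.Dminus s lam) =
        1 / 2 * Real.log (GapProb.D s lam)
          + 1 / 2 * ∫ x in (0 : ℝ)..s, Real.sqrt (GapProb.negLogDeriv2 lam x)) := by
  have hpos := GapProb.D_pos hD
  refine ⟨fun x hx => ⟨hpos x hx, ?_, ?_⟩,
    fun x hx => GapProb.analyticAt_log_D hx.1 (hpos x (Set.Ioc_subset_Icc_self hx)), ?_,
    fun w hw => GapProb.log_Dplus_Dminus_eq hs.le hpos (hw.eq_edgeCross hs hpos), fun h => ?_⟩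
  · rw [GapProb.Dplus_eq_parityDet]
    exact GapProb.parityDet_pos (Or.inl rfl) hx.1 fun y hy => hpos y ⟨hy.1, hy.2.trans hx.2⟩
  · rw [GapProb.Dminus_eq_parityDet]
    exact GapProb.parityDet_pos (Or.inr rfl) hx.1 fun y hy => hpos y ⟨hy.1, hy.2.trans hx.2⟩
  · obtain ⟨w, hw, hw0, hwb⟩ := GapProb.exists_analytic_edgeCross hs hpos
    exact ⟨w, hw, hw0, fun x hx => by rw [hwb x hx, GapProb.negLogDeriv2_eq hpos hx]⟩
  · have hb := GapProb.edgeCross_pos hpos h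
    refine ⟨fun x hx => ?_, GapProb.log_Dplus_Dminus_eq hs.le hpos fun x hx => ?_⟩
    · rw [GapProb.negLogDeriv2_eq hpos hx]
      exact pow_pos (hb x hx) 2
    · rw [GapProb.negLogDeriv2_eq hpos hx, Real.sqrt_sq (hb x hx).le]
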